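/- Let $d\ge 1$ and let $f=f(u,x)\in C^2(\mathbb R,C^1(\mathbb R^d))$ be an $\mathbb R^d$-valued flux that is periodic in $x$ with period cell $Y=\prod_{i=1}^d(0,T_i)$, $T_i>0$. Let $K^t(x)=(4\pi t)^{-d/2}e^{-|x|^2/4t}$ be the heat kernel. For $u_0\in L^\infty(\mathbb R^d)$, a global solution of $$\partial_t u+\operatorname{div}(f(u,x))=\Delta u\quad(t>0,\ x\in\mathbb R^d),\qquad u(0,\cdot)=u_0,$$ means a mild solution: a measurable function $u$, bounded on $(0,\tau]\times\mathbb R^d$ for every $\tau>0$, with $$u(t,\cdot)=K^t*u_0-\int_0^t\nabla K^{t-s}*f(u(s,\cdot),\cdot)\,ds\qquad\text{for all }t>0 .$$ For every $u_0\in L^\infty(\mathbb R^d)$ there is at most one global solution $u$; if it exists, we write $S^tu_0=u(t,\cdot)$ for $t>0$. If $\partial_uf$ is bounded on $\mathbb R\times Y$, then it exists for every $u_0\in L^\infty(\mathbb R^d)$, so that $S^t$ is defined on all of $L^\infty(\mathbb R^d)$. Proposition ($L^1$-contraction and conservation of mass). For all $u_0,v_0\in L^\infty(\mathbb R^d)$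 for which $S^tu_0$ and $S^tv_0$ are defined (hence for all $u_0,v_0\in L^\infty(\mathbb R^d)$ if $\partial_uf$ is bounded) and such that $u_0-v_0\in L^1(\mathbb R^d)$, and for all $t>0$: (i) $S^tu_0-S^tv_0\in L^1(\mathbb R^d)$ and $\|S^tu_0-S^tv_0\|_1\le\|u_0-v_0\|_1$; (ii) $\displaystyle\int_{\mathbb R^d}(S^tu_0-S^tv_0)\,dx=\int_{\mathbb R^d}(u_0-v_0)\,dx$. -/

import Mathlib

open MeasureTheory Set

noncomputable section

/-- The heat kernel `K^t(x) = (4πt)^{-d/2} exp(-‖x‖² / (4t))` on `ℝ^d`. -/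
def heatKernel {d : ℕ} (t : ℝ) (x : EuclideanSpace ℝ (Fin d)) : ℝ :=
  (4 * Real.pi * t) ^ (-(d : ℝ) / 2) * Real.exp (-‖x‖ ^ 2 / (4 * t))

/-- The flux `f = f(u, x)` belongs to `C²(ℝ, C¹(ℝ^d))`, where `C¹(ℝ^d)` carries the topology of
locally uniform convergence of a function and of its gradient: for `k ≤ 2`, the derivatives
`∂_u^k f` exist, they are `C¹` in `x`, and `∂_u^k f`, `∇_x ∂_u^k f` are continuous in `(u, x)`. -/
structure IsC2C1Flux {d : ℕ}
    (f : ℝ → EuclideanSpace ℝ (Fin d) → EuclideanSpace ℝ (Fin d)) : Prop where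
  contDiff_left : ∀ x, ContDiff ℝ 2 (fun u => f u x)
  contDiff_right : ∀ k ≤ 2, ∀ u, ContDiff ℝ 1 (fun x => iteratedDeriv k (fun w => f w x) u)
  continuous_deriv : ∀ k ≤ 2, Continuous
    (fun p : ℝ × EuclideanSpace ℝ (Fin d) => iteratedDeriv k (fun w => f w p.2) p.1)
  continuous_fderiv : ∀ k ≤ 2, Continuous
    (fun p : ℝ × EuclideanSpace ℝ (Fin d) =>
      fderiv ℝ (fun x => iteratedDeriv k (fun w => f w x) p.1) p.2)

/-- The flux is `Y`-periodic in `x`, with `Y = ∏ᵢ (0, Tᵢ)`. -/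
def IsPeriodicFlux {d : ℕ} (T : Fin d → ℝ)
    (f : ℝ → EuclideanSpace ℝ (Fin d) → EuclideanSpace ℝ (Fin d)) : Prop :=
  ∀ (i : Fin d) (u : ℝ) (x : EuclideanSpace ℝ (Fin d)),
    f u (x + EuclideanSpace.single i (T i)) = f u x

/-- `u` is a global mild solution, in `L^∞_loc([0, ∞); L^∞(ℝ^d))`, of
`∂ₜu + div (f(u, x)) = Δu` for `t > 0`, `u(0, ·) = u₀`: it is measurable, bounded on bounded time
intervals, and satisfies Duhamel's formula
`u(t) = K^t * u₀ - ∫₀ᵗ ∇K^{t-s} * f(u(s, ·), ·) ds` for `t > 0`,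
where `(∇K^{t-s} * g)(x) = ∫ ∇K^{t-s}(x - y) ⬝ g(y) dy` for a vector field `g`.
The values of `u` at times `t ≤ 0` are irrelevant. -/
structure IsMildSolution {d : ℕ}
    (f : ℝ → EuclideanSpace ℝ (Fin d) → EuclideanSpace ℝ (Fin d))
    (u₀ : EuclideanSpace ℝ (Fin d) → ℝ) (u : ℝ → EuclideanSpace ℝ (Fin d) → ℝ) : Prop where
  aestronglyMeasurable : AEStronglyMeasurable (Function.uncurry u)
    ((volume.restrict (Ioi (0 : ℝ))).prod (volume : Measure (EuclideanSpace ℝ (Fin d))))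
  bounded : ∀ τ : ℝ, ∃ C : ℝ, ∀ t ∈ Ioc 0 τ, ∀ x, |u t x| ≤ C
  duhamel : ∀ t : ℝ, 0 < t → ∀ x,
    u t x = (∫ y, heatKernel t (x - y) * u₀ y) -
      ∫ s in (0 : ℝ)..t, ∫ y, inner ℝ (gradient (heatKernel (t - s)) (x - y)) (f (u s y) y)

open Classical in
/-- The nonlinear semigroup: `S^t u₀` is the value at time `t > 0` of the global mild solution with
initial datum `u₀`. (The value `0` is used only if `u₀` admits no global mild solution.) -/
def nonlinearSemigroup {d : ℕ}
    (f : ℝ → EuclideanSpace ℝ (Fin d) → EuclideanSpace ℝ (Fin d))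
    (t : ℝ) (u₀ : EuclideanSpace ℝ (Fin d) → ℝ) : EuclideanSpace ℝ (Fin d) → ℝ :=
  if h : ∃ u, IsMildSolution f u₀ u then h.choose t else 0

end

/-!
Two mild solutions `u`, `v` solve a linear problem: their difference `w = u - v` satisfies
`∂ₜw + div (b w) = Δw` in Duhamel form, where `b = (f(u) - f(v)) / (u - v)` is a drift that is
merely measurable and bounded on bounded time intervals. It therefore suffices to show that this linear
equation conserves mass and does not increase the `L¹` norm.

Existence and uniqueness are Picard iteration (`IsLipschitzVolterra.exists_fixed`,
`IsLipschitzVolterra.eq_of_fixed`): since `‖∇K^t‖₁ ≤ c t^{-1/2}`, the Duhamel operator contracts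
in the sup norm with an exponential weight in time. For uniqueness the flux is truncated at the
bound of the two solutions; periodicity and continuity make the truncated flux globally Lipschitz.

For the `L¹` bound there is no regularity of `b` to exploit, so the drift is approximated by an
operator for which the bound is visible. The pointwise estimate `|∇K^δ| ≤ c δ^{-1/2} K^{2δ}`
(`norm_heatKernelGrad_le`) shows that, for `lam = ‖b‖ c δ^{-1/2}`, the operator
`B w = lam K^{2δ} * w - ∇K^δ * (b w)` has a nonnegative kernel of mass `lam`
(`driftKernel_nonneg`, `integral_driftKernel`). The equation `∂ₜW = ΔW + B W - lam W`, with the loss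
term absorbed into the semigroup as `e^{-lam t} K^t`, has nonnegative kernels of total mass one, so
each of its Picard iterates, and by Fatou's lemma its solution, stays below `‖w₀‖₁` in `L¹`
(`exists_approx_solution`). Rewritten without the exponential factor (`approx_duhamel`, a scalar
variation of constants made possible by the semigroup property of `K^t`), the equation
differs from that of `w` by terms controlled by `∇K^{τ + δ} - ∇K^τ` and `lam (K^{τ + 2δ} - K^τ)`,
which are `O(δ^{1/4} τ^{-3/4})` in `L¹` (`exists_consistency_bound`). Hence `W → w` uniformly as
`δ → 0` (`IsLinearSolution.approx_sub_le`), and Fatou's lemma gives `‖w(t)‖₁ ≤ ‖w₀‖₁`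
(`IsLinearSolution.lintegral_le`). The bound makes Fubini's theorem applicable to the
Duhamel formula, and `∫ ∇K^t = 0` gives conservation of mass (`IsLinearSolution.integral_eq`).
-/

open MeasureTheory Set
open Filter Topology

/-! ### Volterra equations with a weakly singular kernel -/

section Weights

lemma indicator_Ioi_sub (F : ℝ → ℝ) (t : ℝ) :
    (fun s => (Ioi (0 : ℝ)).indicator F (t - s)) = (Iio t).indicator (fun s => F (t - s)) := by
  ext s
  by_cases hs : s < t
  · simp [indicator, hs]
  · simp [indicator, hs]

lemma integrableOn_comp_sub {F : ℝ → ℝ} (hF : IntegrableOn F (Ioi 0)) (t : ℝ) :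
    IntegrableOn (fun s => F (t - s)) (Iio t) := by
  have h := ((integrable_indicator_iff measurableSet_Ioi).2 hF).comp_sub_left t
  rw [indicator_Ioi_sub] at h
  exact (integrable_indicator_iff measurableSet_Iio).1 h

lemma integral_comp_sub_Iio (F : ℝ → ℝ) (t : ℝ) :
    ∫ s in Iio t, F (t - s) = ∫ s in Ioi 0, F s := by
  rw [← integral_indicator measurableSet_Iio, ← integral_indicator measurableSet_Ioi,
    ← indicator_Ioi_sub]
  exact integral_sub_left_eq_self _ volume t

lemma integrableOn_rpow_mul_exp_neg {m : ℝ} (hm : 0 < m) :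
    IntegrableOn (fun s : ℝ => s ^ (-(1 / 2) : ℝ) * Real.exp (-m * s)) (Ioi 0) := by
  have := integrableOn_rpow_mul_exp_neg_mul_rpow (s := -(1 / 2)) (p := 1) (by norm_num) one_pos hm
  simpa using this

lemma integrableOn_rpow_mul_exp {m : ℝ} (hm : 0 < m) (t : ℝ) :
    IntegrableOn (fun s => (t - s) ^ (-(1 / 2) : ℝ) * Real.exp (m * s)) (Ioo 0 t) := by
  have h := integrableOn_rpow_mul_exp_neg hm
  refine IntegrableOn.congr_fun (((integrableOn_comp_sub h t).mono_set
    Ioo_subset_Iio_self).const_mul (Real.exp (m * t))) (fun s _ => ?_) measurableSet_Ioo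
  have : Real.exp (m * s) = Real.exp (m * t) * Real.exp (-m * (t - s)) := by
    rw [← Real.exp_add]; ring_nf
  simp only [this]
  ring

lemma setIntegral_rpow_mul_exp_le {m : ℝ} (hm : 0 < m) (t : ℝ) :
    ∫ s in Ioo 0 t, (t - s) ^ (-(1 / 2) : ℝ) * Real.exp (m * s) ≤
      √(Real.pi / m) * Real.exp (m * t) := by
  have h := integrableOn_rpow_mul_exp_neg hm
  have e : ∀ s : ℝ, (t - s) ^ (-(1 / 2) : ℝ) * Real.exp (m * s) =
      Real.exp (m * t) * ((t - s) ^ (-(1 / 2) : ℝ) * Real.exp (-m * (t - s))) := by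
    intro s
    have : Real.exp (m * s) = Real.exp (m * t) * Real.exp (-m * (t - s)) := by
      rw [← Real.exp_add]; ring_nf
    rw [this]; ring
  simp_rw [e]
  rw [integral_const_mul, mul_comm]
  gcongr
  calc _ ≤ ∫ s in Iio t, (t - s) ^ (-(1 / 2) : ℝ) * Real.exp (-m * (t - s)) := by
        refine setIntegral_mono_set (integrableOn_comp_sub h t) ?_
          Ioo_subset_Iio_self.eventuallyLE
        filter_upwards [ae_restrict_mem measurableSet_Iio] with s hs
        have : 0 ≤ t - s := by have := mem_Iio.1 hs; linarith
        exact mul_nonneg (Real.rpow_nonneg this _) (Real.exp_pos _).le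
    _ = ∫ s in Ioi 0, s ^ ((1 / 2 : ℝ) - 1) * Real.exp (-(m * s)) := by
        rw [integral_comp_sub_Iio (fun s => s ^ (-(1 / 2) : ℝ) * Real.exp (-m * s))]
        norm_num
    _ = √(Real.pi / m) := by
        rw [Real.integral_rpow_mul_exp_neg_mul_Ioi (by norm_num) hm, Real.Gamma_one_half_eq,
          ← Real.sqrt_eq_rpow, ← Real.sqrt_mul (by positivity)]
        congr 1; ring

lemma setIntegral_sub_comp (F : ℝ → ℝ) {t : ℝ} (ht : 0 ≤ t) :
    ∫ s in Ioo 0 t, F (t - s) = ∫ s in Ioo 0 t, F s := by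
  rw [← integral_Ioc_eq_integral_Ioo, ← integral_Ioc_eq_integral_Ioo,
    ← intervalIntegral.integral_of_le ht, ← intervalIntegral.integral_of_le ht]
  simp

lemma integrableOn_rpow_Ioo {p : ℝ} (hp : -1 < p) (t : ℝ) :
    IntegrableOn (fun s => (t - s) ^ p) (Ioo 0 t) := by
  rcases le_or_gt t 0 with ht | ht
  · simp [Ioo_eq_empty_of_le ht]
  have h := (intervalIntegral.intervalIntegrable_rpow' (a := 0) (b := t) hp)
  have h2 := (h.comp_sub_left t)
  simp only [sub_zero, sub_self] at h2
  exact ((intervalIntegrable_iff_integrableOn_Ioo_of_le ht.le).1 h2.symm)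

lemma setIntegral_rpow_Ioo {p : ℝ} (hp : -1 < p) {t : ℝ} (ht : 0 ≤ t) :
    ∫ s in Ioo 0 t, (t - s) ^ p = t ^ (p + 1) / (p + 1) := by
  rw [setIntegral_sub_comp (fun s => s ^ p) ht, ← integral_Ioc_eq_integral_Ioo,
    ← intervalIntegral.integral_of_le ht, integral_rpow (Or.inl hp),
    Real.zero_rpow (by linarith)]
  simp

end Weights

section Volterra

variable {X : Type*} [MeasurableSpace X] {μ : Measure X}

/-- Domination of an iterated integral over `(0, t) × X`, fibre by fibre. -/
lemma iterated_integral_bound [SFinite μ] {h : ℝ → X → ℝ} {a : ℝ → ℝ} {t : ℝ}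
    (hm : Measurable (Function.uncurry h))
    (hQ : ∀ s ∈ Ioo 0 t, ∃ Q : X → ℝ, Integrable Q μ ∧ ∫ y, Q y ∂μ ≤ a s ∧ ∀ y, |h s y| ≤ Q y)
    (ha : IntegrableOn a (Ioo 0 t)) :
    (∀ s ∈ Ioo 0 t, Integrable (h s) μ) ∧ IntegrableOn (fun s => ∫ y, h s y ∂μ) (Ioo 0 t) ∧
      |∫ s in Ioo 0 t, ∫ y, h s y ∂μ| ≤ ∫ s in Ioo 0 t, a s := by
  have h1 : ∀ s ∈ Ioo 0 t, Integrable (h s) μ := fun s hs => by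
    obtain ⟨Q, hQi, -, hQb⟩ := hQ s hs
    exact hQi.mono' (hm.comp measurable_prodMk_left).aestronglyMeasurable
      (Eventually.of_forall hQb)
  have h2 : ∀ s ∈ Ioo 0 t, ‖∫ y, h s y ∂μ‖ ≤ a s := fun s hs => by
    obtain ⟨Q, hQi, hQa, hQb⟩ := hQ s hs
    exact (norm_integral_le_of_norm_le hQi (Eventually.of_forall hQb)).trans hQa
  have h3 : ∀ᵐ s ∂(volume.restrict (Ioo 0 t)), ‖∫ y, h s y ∂μ‖ ≤ a s := by
    filter_upwards [ae_restrict_mem measurableSet_Ioo] with s hs using h2 s hs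
  refine ⟨h1, ha.mono' ?_ h3, norm_integral_le_of_norm_le ha h3⟩
  exact (hm.stronglyMeasurable.integral_prod_right).aestronglyMeasurable

/-- The nonlinear Volterra operator
`u ↦ g(t, x) + ∫₀ᵗ ∫ N(t, s, x, y, u(s, y)) dμ(y) ds`. -/
noncomputable def volterra (μ : Measure X) (g : ℝ → X → ℝ) (N : ℝ → ℝ → X → X → ℝ → ℝ)
    (u : ℝ → X → ℝ) : ℝ → X → ℝ :=
  fun t x => g t x + ∫ s in Ioo 0 t, ∫ y, N t s x y (u s y) ∂μ

/-- The kernel `N` is measurable, and for `0 < s < t` it is Lipschitz in its last variable, with a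
constant whose integral over `X` is at most `A (t - s)^{-1/2}`; its value at `0` is at most `F`
times that constant. -/
structure IsLipschitzVolterra (μ : Measure X) (N : ℝ → ℝ → X → X → ℝ → ℝ) (A F : ℝ) : Prop where
  nonneg_left : 0 ≤ A
  nonneg_right : 0 ≤ F
  measurable : Measurable fun p : (ℝ × ℝ) × (X × X) × ℝ => N p.1.1 p.1.2 p.2.1.1 p.2.1.2 p.2.2
  dominated : ∀ t s x, 0 < s → s < t → ∃ Q : X → ℝ, Integrable Q μ ∧
    ∫ y, Q y ∂μ ≤ A * (t - s) ^ (-(1 / 2) : ℝ) ∧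
    ∀ y, |N t s x y 0| ≤ Q y * F ∧ ∀ r r', |N t s x y r - N t s x y r'| ≤ Q y * |r - r'|

/-- A rate of exponential weights for which a Volterra operator with constant `A` contracts by the
factor `1/2`. -/
noncomputable def volterraRate (A : ℝ) : ℝ := 4 * Real.pi * A ^ 2 + 1

lemma volterraRate_pos (A : ℝ) : 0 < volterraRate A := by
  unfold volterraRate; positivity

lemma mul_sqrt_volterraRate_le {A : ℝ} (hA : 0 ≤ A) : A * √(Real.pi / volterraRate A) ≤ 1 / 2 := by
  have hp := volterraRate_pos A
  have : A * √(Real.pi / volterraRate A) = √(A ^ 2 * (Real.pi / volterraRate A)) := by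
    rw [Real.sqrt_mul (by positivity), Real.sqrt_sq hA]
  rw [this, Real.sqrt_le_left (by norm_num), ← mul_div_assoc, div_le_iff₀ hp]
  unfold volterraRate
  nlinarith

variable {N : ℝ → ℝ → X → X → ℝ → ℝ} {A F : ℝ} {g u v : ℝ → X → ℝ}

lemma measurable_volterra_section
    (hN : Measurable fun p : (ℝ × ℝ) × (X × X) × ℝ => N p.1.1 p.1.2 p.2.1.1 p.2.1.2 p.2.2)
    (hu : Measurable (Function.uncurry u)) (t : ℝ) (x : X) :
    Measurable (Function.uncurry fun s y => N t s x y (u s y)) :=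
  hN.comp (g := fun p : (ℝ × ℝ) × (X × X) × ℝ => N p.1.1 p.1.2 p.2.1.1 p.2.1.2 p.2.2)
    (f := fun q : ℝ × X => ((t, q.1), (x, q.2), u q.1 q.2))
    ((measurable_const.prodMk measurable_fst).prodMk
      ((measurable_const.prodMk measurable_snd).prodMk hu))

lemma measurable_volterra [SFinite μ]
    (hN : Measurable fun p : (ℝ × ℝ) × (X × X) × ℝ => N p.1.1 p.1.2 p.2.1.1 p.2.1.2 p.2.2)
    (hg : Measurable (Function.uncurry g)) (hu : Measurable (Function.uncurry u)) :
    Measurable (Function.uncurry (volterra μ g N u)) := by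
  have h1 : Measurable fun q : ((ℝ × X) × ℝ) × X => N q.1.1.1 q.1.2 q.1.1.2 q.2 (u q.1.2 q.2) :=
    hN.comp (g := fun p : (ℝ × ℝ) × (X × X) × ℝ => N p.1.1 p.1.2 p.2.1.1 p.2.1.2 p.2.2)
      (f := fun q : ((ℝ × X) × ℝ) × X =>
        ((q.1.1.1, q.1.2), (q.1.1.2, q.2), u q.1.2 q.2))
      ((by fun_prop : Measurable fun q : ((ℝ × X) × ℝ) × X => (q.1.1.1, q.1.2)).prodMk
        ((by fun_prop : Measurable fun q : ((ℝ × X) × ℝ) × X => (q.1.1.2, q.2)).prodMk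
          (hu.comp (by fun_prop : Measurable fun q : ((ℝ × X) × ℝ) × X => (q.1.2, q.2)))))
  have h2 := h1.stronglyMeasurable.integral_prod_right' (ν := μ)
  have h3 : StronglyMeasurable fun q : (ℝ × X) × ℝ =>
      (Ioo 0 q.1.1).indicator (fun s => ∫ y, N q.1.1 s q.1.2 y (u s y) ∂μ) q.2 := by
    have hs : MeasurableSet {q : (ℝ × X) × ℝ | q.2 ∈ Ioo 0 q.1.1} :=
      (measurableSet_lt measurable_const measurable_snd).inter
        (measurableSet_lt measurable_snd (by fun_prop))
    exact h2.indicator hs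
  have h4 := h3.integral_prod_right' (ν := volume)
  refine hg.add ?_
  convert h4.measurable using 2 with q
  exact (integral_indicator measurableSet_Ioo).symm

namespace IsLipschitzVolterra

lemma dominated_of_bounded (hN : IsLipschitzVolterra μ N A F) {t s C : ℝ} (hs : s ∈ Ioo 0 t)
    (hC : ∀ y, |u s y| ≤ C) (x : X) : ∃ Q : X → ℝ, Integrable Q μ ∧
      ∫ y, Q y ∂μ ≤ A * (F + C) * (t - s) ^ (-(1 / 2) : ℝ) ∧ ∀ y, |N t s x y (u s y)| ≤ Q y := by
  obtain ⟨Q, hQi, hQA, hQ⟩ := hN.dominated t s x hs.1 hs.2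
  have hC0 : 0 ≤ C := (abs_nonneg _).trans (hC x)
  refine ⟨fun y => Q y * (F + C), hQi.mul_const _, ?_, fun y => ?_⟩
  · rw [integral_mul_const]
    have := mul_le_mul_of_nonneg_right hQA (add_nonneg hN.nonneg_right hC0)
    linarith
  · have hQ0 : 0 ≤ Q y := by simpa using (abs_nonneg _).trans ((hQ y).2 1 0)
    have h1 := (hQ y).2 (u s y) 0
    rw [sub_zero] at h1
    have h2 := mul_le_mul_of_nonneg_left (hC y) hQ0
    have h3 := abs_sub_abs_le_abs_sub (N t s x y (u s y)) (N t s x y 0)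
    linarith [(hQ y).1]

lemma iterated_integrable [SFinite μ] (hN : IsLipschitzVolterra μ N A F)
    (hu : Measurable (Function.uncurry u)) {t C : ℝ} (hC : ∀ s ∈ Ioo 0 t, ∀ y, |u s y| ≤ C)
    (x : X) : (∀ s ∈ Ioo 0 t, Integrable (fun y => N t s x y (u s y)) μ) ∧
      IntegrableOn (fun s => ∫ y, N t s x y (u s y) ∂μ) (Ioo 0 t) ∧
      |∫ s in Ioo 0 t, ∫ y, N t s x y (u s y) ∂μ| ≤
        ∫ s in Ioo 0 t, A * (F + C) * (t - s) ^ (-(1 / 2) : ℝ) :=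
  iterated_integral_bound (measurable_volterra_section hN.measurable hu t x)
    (fun _ hs => hN.dominated_of_bounded hs (hC _ hs) x)
    ((integrableOn_rpow_Ioo (by norm_num) t).const_mul _)

/-- In exponential weights, the Volterra operator contracts by the factor `1/2`. -/
lemma contraction [SFinite μ] (hN : IsLipschitzVolterra μ N A F)
    (hu : Measurable (Function.uncurry u)) (hv : Measurable (Function.uncurry v)) {t C D : ℝ}
    (huC : ∀ s ∈ Ioo 0 t, ∀ y, |u s y| ≤ C) (hvC : ∀ s ∈ Ioo 0 t, ∀ y, |v s y| ≤ C)
    (hD : 0 ≤ D)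
    (huv : ∀ s ∈ Ioo 0 t, ∀ y, |u s y - v s y| ≤ D * Real.exp (volterraRate A * s)) (x : X) :
    |volterra μ g N u t x - volterra μ g N v t x| ≤
      D / 2 * Real.exp (volterraRate A * t) := by
  obtain ⟨hu1, hu2, -⟩ := hN.iterated_integrable hu huC x
  obtain ⟨hv1, hv2, -⟩ := hN.iterated_integrable hv hvC x
  have e : volterra μ g N u t x - volterra μ g N v t x =
      ∫ s in Ioo 0 t, ∫ y, (N t s x y (u s y) - N t s x y (v s y)) ∂μ := by
    simp only [volterra, add_sub_add_left_eq_sub]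
    rw [← integral_sub hu2 hv2]
    exact setIntegral_congr_fun measurableSet_Ioo
      fun s hs => (integral_sub (hu1 s hs) (hv1 s hs)).symm
  have hm := volterraRate_pos A
  rw [e]
  refine (iterated_integral_bound
    (h := fun s y => N t s x y (u s y) - N t s x y (v s y))
    (a := fun s => A * D * ((t - s) ^ (-(1 / 2) : ℝ) * Real.exp (volterraRate A * s)))
    ((measurable_volterra_section hN.measurable hu t x).sub
      (measurable_volterra_section hN.measurable hv t x)) (fun s hs => ?_)
    ((integrableOn_rpow_mul_exp hm t).const_mul _)).2.2.trans ?_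
  · obtain ⟨Q, hQi, hQA, hQ⟩ := hN.dominated t s x hs.1 hs.2
    refine ⟨fun y => Q y * (D * Real.exp (volterraRate A * s)), hQi.mul_const _, ?_, fun y => ?_⟩
    · rw [integral_mul_const]
      have := mul_le_mul_of_nonneg_right hQA (mul_nonneg hD (Real.exp_pos (volterraRate A * s)).le)
      linarith
    · have hQ0 : 0 ≤ Q y := by simpa using (abs_nonneg _).trans ((hQ y).2 1 0)
      exact ((hQ y).2 _ _).trans (mul_le_mul_of_nonneg_left (huv s hs y) hQ0)
  · rw [integral_const_mul]
    have h1 := mul_le_mul_of_nonneg_left (setIntegral_rpow_mul_exp_le hm t)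
      (mul_nonneg hN.nonneg_left hD)
    have h2 := mul_le_mul_of_nonneg_right (mul_sqrt_volterraRate_le hN.nonneg_left)
      (mul_nonneg hD (Real.exp_pos (volterraRate A * t)).le)
    linarith

end IsLipschitzVolterra

/-- An a priori bounded quantity is at most `2c` if each bound `D` of it improves to `D/2 + c`. -/
lemma le_of_halving {ι : Sort*} {φ : ι → ℝ} {c D₀ : ℝ} (hc : 0 ≤ c) (hD₀ : 0 ≤ D₀)
    (h₀ : ∀ i, φ i ≤ D₀) (h : ∀ D, 0 ≤ D → (∀ i, φ i ≤ D) → ∀ i, φ i ≤ D / 2 + c) (i : ι) :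
    φ i ≤ 2 * c := by
  have key : ∀ n : ℕ, ∀ i, φ i ≤ 2 * c + D₀ * (1 / 2) ^ n := by
    intro n
    induction n with
    | zero => intro i; linarith [h₀ i]
    | succ n ih =>
      intro i
      have := h _ (by positivity) ih i
      rw [pow_succ]
      linarith
  have ht : Tendsto (fun n : ℕ => 2 * c + D₀ * (1 / 2) ^ n) atTop (𝓝 (2 * c + D₀ * 0)) :=
    ((tendsto_pow_atTop_nhds_zero_of_lt_one (by norm_num) (by norm_num)).const_mul _).const_add _
  simpa using ge_of_tendsto' ht (fun n => key n i)

lemma le_mul_exp_iff (a b c : ℝ) : a * Real.exp (-c) ≤ b ↔ a ≤ b * Real.exp c := by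
  rw [Real.exp_neg, ← div_eq_mul_inv, div_le_iff₀ (Real.exp_pos c)]

lemma IsLipschitzVolterra.eq_of_fixed [SFinite μ] (hN : IsLipschitzVolterra μ N A F)
    (hu : Measurable (Function.uncurry u)) (hv : Measurable (Function.uncurry v)) {T C : ℝ}
    (huC : ∀ s ∈ Ioc 0 T, ∀ y, |u s y| ≤ C) (hvC : ∀ s ∈ Ioc 0 T, ∀ y, |v s y| ≤ C)
    (hu' : ∀ t ∈ Ioc 0 T, ∀ x, u t x = volterra μ g N u t x)
    (hv' : ∀ t ∈ Ioc 0 T, ∀ x, v t x = volterra μ g N v t x) :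
    ∀ t ∈ Ioc 0 T, ∀ x, u t x = v t x := by
  intro t ht x
  have key := le_of_halving (ι := Ioc 0 T × X) (c := 0) (D₀ := 2 * |C|)
    (φ := fun p => |u p.1 p.2 - v p.1 p.2| * Real.exp (-(volterraRate A * p.1))) le_rfl
    (by positivity) ?_ ?_ (⟨t, ht⟩, x)
  · simp only [mul_zero] at key
    have : |u t x - v t x| ≤ 0 := by
      have := (le_mul_exp_iff _ _ _).1 key
      simpa using this
    have := abs_nonpos_iff.1 this
    linarith
  · rintro ⟨⟨s, hs⟩, y⟩
    have h1 : Real.exp (-(volterraRate A * s)) ≤ 1 := by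
      rw [Real.exp_le_one_iff]
      have := mul_pos (volterraRate_pos A) hs.1
      linarith
    have h2 : |u s y - v s y| ≤ 2 * |C| := by
      have := abs_sub (u s y) (v s y)
      linarith [huC s hs y, hvC s hs y, le_abs_self C]
    calc _ ≤ (2 * |C|) * 1 := by dsimp only; gcongr
      _ = _ := by ring
  · rintro D hD hφ ⟨⟨s, hs⟩, y⟩
    have h := hN.contraction (g := g) hu hv (t := s) (C := C) (D := D)
      (fun r hr => huC r ⟨hr.1, hr.2.le.trans hs.2⟩)
      (fun r hr => hvC r ⟨hr.1, hr.2.le.trans hs.2⟩) hD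
      (fun r hr z => (le_mul_exp_iff _ _ _).1 (hφ (⟨r, hr.1, hr.2.le.trans hs.2⟩, z))) y
    rw [← hu' s hs y, ← hv' s hs y] at h
    rw [add_zero]
    exact (le_mul_exp_iff _ _ _).2 h

/-- The Picard iterates of the Volterra operator, starting from `0`. -/
noncomputable def picard (μ : Measure X) (g : ℝ → X → ℝ) (N : ℝ → ℝ → X → X → ℝ → ℝ) :
    ℕ → ℝ → X → ℝ
  | 0 => 0
  | n + 1 => volterra μ g N (picard μ g N n)

/-- The Picard iterates converge to a fixed point of the Volterra operator. -/
theorem IsLipschitzVolterra.exists_fixed [SFinite μ] (hN : IsLipschitzVolterra μ N A F)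
    (hg : Measurable (Function.uncurry g)) {G : ℝ} (hG : ∀ t x, |g t x| ≤ G) :
    (∀ n, Measurable (Function.uncurry (picard μ g N n))) ∧
    ∃ u : ℝ → X → ℝ, Measurable (Function.uncurry u) ∧
      (∀ t x, Tendsto (fun n => picard μ g N n t x) atTop (𝓝 (u t x))) ∧
      (∀ T, ∃ C, ∀ t ∈ Ioc 0 T, ∀ x, |u t x| ≤ C) ∧
      (∀ t > 0, ∀ x, u t x = volterra μ g N u t x) := by
  set m := volterraRate A with hm_def
  have hm : 0 < m := volterraRate_pos A
  rcases isEmpty_or_nonempty X with hX | ⟨⟨x₀⟩⟩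
  · refine ⟨fun n => measurable_of_empty _, 0, measurable_of_empty _, fun t x => hX.elim x,
      fun T => ⟨0, fun t _ x => hX.elim x⟩, fun t _ x => hX.elim x⟩
  have hG0 : 0 ≤ G := (abs_nonneg _).trans (hG 0 x₀)
  have hF := hN.nonneg_right
  have hA := hN.nonneg_left
  have hmeas : ∀ n, Measurable (Function.uncurry (picard μ g N n)) := by
    intro n
    induction n with
    | zero => exact measurable_const
    | succ n ih => exact measurable_volterra hN.measurable hg ih
  set D := G + F with hD
  have hD0 : 0 ≤ D := add_nonneg hG0 hF
  have hexp : ∀ t : ℝ, 1 ≤ Real.exp (m * |t|) := fun t => Real.one_le_exp (by positivity)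
  have step : ∀ n : ℕ, (∀ t x, |picard μ g N n t x| ≤ 2 * D * (1 - (1 / 2) ^ n) *
      Real.exp (m * |t|)) ∧
      ∀ t x, |picard μ g N (n + 1) t x - picard μ g N n t x| ≤
        D * (1 / 2) ^ n * Real.exp (m * |t|) := by
    intro n
    induction n with
    | zero =>
      refine ⟨fun t x => by simp [picard], fun t x => ?_⟩
      have hb := (hN.iterated_integrable (u := 0) (t := t) (C := 0) measurable_const
        (by simp) x).2.2
      have hs := setIntegral_rpow_mul_exp_le hm t
      have hle : ∫ s in Ioo 0 t, A * (F + 0) * (t - s) ^ (-(1 / 2) : ℝ) ≤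
          A * F * ∫ s in Ioo 0 t, (t - s) ^ (-(1 / 2) : ℝ) * Real.exp (m * s) := by
        rw [add_zero, integral_const_mul]
        refine mul_le_mul_of_nonneg_left ?_ (by positivity)
        refine setIntegral_mono_on (integrableOn_rpow_Ioo (by norm_num) t)
          (integrableOn_rpow_mul_exp hm t) measurableSet_Ioo fun s hs => ?_
        have : 0 ≤ (t - s) ^ (-(1 / 2) : ℝ) := Real.rpow_nonneg (by linarith [hs.2]) _
        exact le_mul_of_one_le_right this (Real.one_le_exp (mul_nonneg hm.le hs.1.le))
      have h1 : A * F * (√(Real.pi / m) * Real.exp (m * t)) ≤ F * Real.exp (m * |t|) := by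
        have h2 := mul_le_mul_of_nonneg_right (mul_sqrt_volterraRate_le hA)
          (mul_nonneg hF (Real.exp_pos (m * t)).le)
        have h3 : Real.exp (m * t) ≤ Real.exp (m * |t|) := by gcongr; exact le_abs_self t
        have h4 := mul_le_mul_of_nonneg_left h3 hF
        have h5 := mul_nonneg hF (Real.exp_pos (m * t)).le
        rw [← hm_def] at h2
        linarith
      have h2 := mul_le_mul_of_nonneg_left hs (mul_nonneg hA hF)
      have h3 : |picard μ g N (0 + 1) t x - picard μ g N 0 t x| ≤
          |g t x| + |∫ s in Ioo 0 t, ∫ y, N t s x y 0 ∂μ| := by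
        simp only [picard, volterra, Pi.zero_apply, sub_zero]
        exact abs_add_le _ _
      simp only [Pi.zero_apply] at hb
      have h4 := mul_le_mul_of_nonneg_left (hexp t) hG0
      rw [pow_zero, hD]
      linarith [hG t x]
    | succ n ih =>
      have hC : ∀ t x, |picard μ g N (n + 1) t x| ≤ 2 * D * (1 - (1 / 2) ^ (n + 1)) *
          Real.exp (m * |t|) := by
        intro t x
        have h1 := ih.1 t x
        have h2 := ih.2 t x
        have h3 := abs_sub_abs_le_abs_sub (picard μ g N (n + 1) t x) (picard μ g N n t x)
        rw [pow_succ]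
        linarith
      refine ⟨hC, fun t x => ?_⟩
      rcases le_or_gt t 0 with ht | ht
      · have : picard μ g N (n + 1 + 1) t x - picard μ g N (n + 1) t x = 0 := by
          simp [picard, volterra, Ioo_eq_empty_of_le ht]
        rw [this, abs_zero]
        positivity
      have hbd : ∀ k : ℕ, (∀ t x, |picard μ g N k t x| ≤ 2 * D * (1 - (1 / 2) ^ k) *
          Real.exp (m * |t|)) → ∀ s ∈ Ioo 0 t, ∀ y, |picard μ g N k s y| ≤
            2 * D * Real.exp (m * t) := by
        intro k hk s hs y
        refine (hk s y).trans ?_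
        have h1 : (1 - (1 / 2 : ℝ) ^ k) ≤ 1 := by
          have : (0 : ℝ) ≤ (1 / 2) ^ k := by positivity
          linarith
        rw [abs_of_pos hs.1]
        have h2 : Real.exp (m * s) ≤ Real.exp (m * t) := by gcongr; exact hs.2.le
        have h3 : 2 * D * (1 - (1 / 2 : ℝ) ^ k) ≤ 2 * D := by
          nlinarith
        exact mul_le_mul h3 h2 (Real.exp_pos _).le (by positivity)
      have h := hN.contraction (g := g) (hmeas (n + 1)) (hmeas n) (t := t)
        (D := D * (1 / 2) ^ n) (hbd _ hC) (hbd _ ih.1) (by positivity)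
        (fun s hs y => by simpa only [abs_of_pos hs.1] using ih.2 s y) x
      refine h.trans (le_of_eq ?_)
      rw [abs_of_pos ht, pow_succ]
      ring
  have hdist : ∀ t x n, dist (picard μ g N n t x) (picard μ g N (n + 1) t x) ≤
      D * Real.exp (m * |t|) * (1 / 2) ^ n := fun t x n => by
    rw [dist_comm, Real.dist_eq]
    refine ((step n).2 t x).trans (le_of_eq (by ring))
  have hlim : ∀ t x, ∃ l, Tendsto (fun n => picard μ g N n t x) atTop (𝓝 l) := fun t x =>
    cauchySeq_tendsto_of_complete (cauchySeq_of_le_geometric _ _ (by norm_num) (hdist t x))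
  choose u hu using hlim
  have huD : ∀ n t x, |picard μ g N n t x - u t x| ≤ 2 * D * (1 / 2) ^ n * Real.exp (m * |t|) := by
    intro n t x
    have := dist_le_of_le_geometric_of_tendsto _ _ (by norm_num) (hdist t x) (hu t x) n
    rw [Real.dist_eq] at this
    refine this.trans (le_of_eq ?_)
    ring
  have humeas : Measurable (Function.uncurry u) :=
    measurable_of_tendsto_metrizable hmeas (tendsto_pi_nhds.2 fun p => hu p.1 p.2)
  have hub : ∀ T, ∀ t ∈ Ioc 0 T, ∀ x, |u t x| ≤ 2 * D * Real.exp (m * T) := fun T t ht x => by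
    have := huD 0 t x
    simp only [picard, Pi.zero_apply, zero_sub, abs_neg, pow_zero, mul_one, abs_of_pos ht.1] at this
    refine this.trans ?_
    gcongr
    exact ht.2
  refine ⟨hmeas, u, humeas, hu, fun T => ⟨_, hub T⟩, fun t ht x => ?_⟩
  have hnb : ∀ n, ∀ s ∈ Ioo 0 t, ∀ y, |picard μ g N n s y| ≤ 2 * D * Real.exp (m * t) := by
    intro n s hs y
    refine ((step n).1 s y).trans ?_
    have h1 : (1 - (1 / 2 : ℝ) ^ n) ≤ 1 := by
      have : (0 : ℝ) ≤ (1 / 2) ^ n := by positivity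
      linarith
    rw [abs_of_pos hs.1]
    have h2 : Real.exp (m * s) ≤ Real.exp (m * t) := by gcongr; exact hs.2.le
    have h3 : 2 * D * (1 - (1 / 2 : ℝ) ^ n) ≤ 2 * D := by nlinarith
    exact mul_le_mul h3 h2 (Real.exp_pos _).le (by positivity)
  have h1 : ∀ n : ℕ, |picard μ g N (n + 1) t x - volterra μ g N u t x| ≤
      2 * D * (1 / 2) ^ n / 2 * Real.exp (m * t) := fun n =>
    hN.contraction (g := g) (hmeas n) humeas (hnb n)
      (fun s hs y => hub t s ⟨hs.1, hs.2.le⟩ y) (by positivity)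
      (fun s hs y => by simpa only [abs_of_pos hs.1] using huD n s y) x
  have h2 : Tendsto (fun n => picard μ g N (n + 1) t x) atTop (𝓝 (volterra μ g N u t x)) := by
    rw [tendsto_iff_dist_tendsto_zero]
    refine squeeze_zero (fun _ => dist_nonneg) (fun n => h1 n) ?_
    have := ((tendsto_pow_atTop_nhds_zero_of_lt_one (r := (1 / 2 : ℝ)) (by norm_num)
      (by norm_num)).const_mul (2 * D)).mul_const (1 / 2 * Real.exp (m * t))
    simp only [mul_zero, zero_mul] at this
    refine this.congr fun n => by ring
  exact tendsto_nhds_unique ((hu t x).comp (tendsto_add_atTop_nat 1)) h2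

end Volterra

/-! ### The heat kernel -/

section HeatKernel

variable {d : ℕ}

lemma heatKernel_nonneg {t : ℝ} (ht : 0 ≤ t) (x : EuclideanSpace ℝ (Fin d)) :
    0 ≤ heatKernel t x := by
  unfold heatKernel; positivity

lemma heatKernel_neg (t : ℝ) (x : EuclideanSpace ℝ (Fin d)) :
    heatKernel t (-x) = heatKernel t x := by
  simp [heatKernel]

lemma measurable_heatKernel :
    Measurable fun p : ℝ × EuclideanSpace ℝ (Fin d) => heatKernel p.1 p.2 := by
  unfold heatKernel; fun_prop

lemma integral_heatKernel {t : ℝ} (ht : 0 < t) :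
    ∫ x : EuclideanSpace ℝ (Fin d), heatKernel t x = 1 := by
  have h := GaussianFourier.integral_rexp_neg_mul_sq_norm
    (V := EuclideanSpace ℝ (Fin d)) (b := 1 / (4 * t)) (by positivity)
  rw [finrank_euclideanSpace_fin] at h
  have e : ∀ x : EuclideanSpace ℝ (Fin d), heatKernel t x =
      (4 * Real.pi * t) ^ (-(d : ℝ) / 2) * Real.exp (-(1 / (4 * t)) * ‖x‖ ^ 2) := by
    intro x
    unfold heatKernel
    congr 2
    ring
  simp_rw [e]
  rw [integral_const_mul, h, div_div_eq_mul_div, div_one,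
    show Real.pi * (4 * t) = 4 * Real.pi * t by ring, ← Real.rpow_add (by positivity)]
  simp [neg_div]

lemma integrable_heatKernel {t : ℝ} (ht : 0 < t) :
    Integrable fun x : EuclideanSpace ℝ (Fin d) => heatKernel t x :=
  integrable_of_integral_eq_one (integral_heatKernel ht)

/-- The spatial gradient of the heat kernel. The formula agrees with `gradient (heatKernel t)` for
every real `t`, since both sides vanish for `t = 0`. -/
noncomputable def heatKernelGrad (t : ℝ) (x : EuclideanSpace ℝ (Fin d)) :
    EuclideanSpace ℝ (Fin d) :=
  -(heatKernel t x / (2 * t)) • x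

lemma gradient_heatKernel (t : ℝ) (x : EuclideanSpace ℝ (Fin d)) :
    gradient (heatKernel t) x = heatKernelGrad t x := by
  apply HasGradientAt.gradient
  rw [hasGradientAt_iff_hasFDerivAt]
  have h1 : HasFDerivAt (fun x : EuclideanSpace ℝ (Fin d) => -‖x‖ ^ 2 / (4 * t))
      ((4 * t)⁻¹ • -(2 • innerSL ℝ x : EuclideanSpace ℝ (Fin d) →L[ℝ] ℝ)) x := by
    have := ((hasStrictFDerivAt_norm_sq x).hasFDerivAt.neg.const_smul ((4 * t)⁻¹))
    refine this.congr_of_eventuallyEq (Eventually.of_forall fun y => ?_)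
    simp [div_eq_inv_mul]
  have h2 := (h1.exp.const_mul ((4 * Real.pi * t) ^ (-(d : ℝ) / 2)))
  refine h2.congr_fderiv ?_
  ext v
  simp only [heatKernelGrad, heatKernel, smul_apply, neg_apply, innerSL_apply_apply,
    InnerProductSpace.toDual_apply_apply, inner_smul_left, smul_eq_mul, nsmul_eq_mul]
  rcases eq_or_ne t 0 with rfl | ht
  · simp
  · simp
    field_simp
    ring

lemma heatKernelGrad_neg (t : ℝ) (x : EuclideanSpace ℝ (Fin d)) :
    heatKernelGrad t (-x) = -heatKernelGrad t x := by
  simp [heatKernelGrad, heatKernel_neg]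

lemma measurable_heatKernelGrad :
    Measurable fun p : ℝ × EuclideanSpace ℝ (Fin d) => heatKernelGrad p.1 p.2 := by
  have := measurable_heatKernel (d := d)
  unfold heatKernelGrad
  fun_prop

/-- The constant of the Gaussian bound on the gradient of the heat kernel. -/
noncomputable def heatConst (d : ℕ) : ℝ := 2 ^ ((d : ℝ) / 2) * 2

lemma heatConst_pos (d : ℕ) : 0 < heatConst d := by unfold heatConst; positivity

lemma heatKernel_eq_two_mul {t : ℝ} (ht : 0 < t) (x : EuclideanSpace ℝ (Fin d)) :
    heatKernel t x =
      2 ^ ((d : ℝ) / 2) * heatKernel (2 * t) x * Real.exp (-(‖x‖ ^ 2 / (8 * t))) := by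
  unfold heatKernel
  have h1 : (4 * Real.pi * t) ^ (-(d : ℝ) / 2) =
      2 ^ ((d : ℝ) / 2) * (4 * Real.pi * (2 * t)) ^ (-(d : ℝ) / 2) := by
    rw [show 4 * Real.pi * (2 * t) = 2 * (4 * Real.pi * t) by ring,
      Real.mul_rpow (x := 2) (by norm_num) (by positivity), ← mul_assoc,
      ← Real.rpow_add (by norm_num), neg_div, add_neg_cancel, Real.rpow_zero, one_mul]
  have h2 : Real.exp (-‖x‖ ^ 2 / (4 * t)) =
      Real.exp (-‖x‖ ^ 2 / (4 * (2 * t))) * Real.exp (-(‖x‖ ^ 2 / (8 * t))) := by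
    rw [← Real.exp_add]
    congr 1
    field_simp
    ring
  rw [h1, h2]
  ring

lemma norm_heatKernelGrad_le {t : ℝ} (ht : 0 < t) (x : EuclideanSpace ℝ (Fin d)) :
    ‖heatKernelGrad t x‖ ≤ heatConst d * t ^ (-(1 / 2) : ℝ) * heatKernel (2 * t) x := by
  have hK := heatKernel_nonneg (t := 2 * t) (by positivity) x
  have hs : 0 < √t := Real.sqrt_pos.2 ht
  have hst : √t * √t = t := Real.mul_self_sqrt ht.le
  have hr : t ^ (-(1 / 2) : ℝ) = (√t)⁻¹ := by
    rw [Real.rpow_neg ht.le, Real.sqrt_eq_rpow]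
  have key : ‖x‖ / (2 * t) * Real.exp (-(‖x‖ ^ 2 / (8 * t))) ≤ 2 * (√t)⁻¹ := by
    have h1 : ‖x‖ ^ 2 / (8 * t) + 1 ≤ Real.exp (‖x‖ ^ 2 / (8 * t)) := Real.add_one_le_exp _
    rw [Real.exp_neg, ← div_eq_mul_inv, div_le_iff₀ (Real.exp_pos _)]
    refine le_trans ?_ (mul_le_mul_of_nonneg_left h1 (by positivity))
    set r := ‖x‖ / √t with hr
    have hx : ‖x‖ = r * √t := by rw [hr]; field_simp
    have e1 : ‖x‖ / (2 * t) = r / 2 * (√t)⁻¹ := by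
      rw [hx]; nth_rw 2 [← hst]; field_simp
    have e2 : ‖x‖ ^ 2 / (8 * t) = r ^ 2 / 8 := by
      rw [hx]; nth_rw 2 [← hst]; field_simp
    rw [e1, e2]
    have : 0 < (√t)⁻¹ := by positivity
    nlinarith [sq_nonneg (r - 1), mul_nonneg this.le (sq_nonneg (r - 1))]
  have e : ‖heatKernelGrad t x‖ = 2 ^ ((d : ℝ) / 2) * heatKernel (2 * t) x *
      (‖x‖ / (2 * t) * Real.exp (-(‖x‖ ^ 2 / (8 * t)))) := by
    rw [heatKernelGrad, norm_smul, norm_neg, Real.norm_eq_abs,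
      abs_of_nonneg (div_nonneg (heatKernel_nonneg ht.le x) (by positivity)),
      heatKernel_eq_two_mul ht]
    ring
  rw [e, hr, heatConst]
  calc _ ≤ 2 ^ ((d : ℝ) / 2) * heatKernel (2 * t) x * (2 * (√t)⁻¹) := by gcongr
    _ = _ := by ring

lemma integrable_heatKernelGrad {t : ℝ} (ht : 0 < t) :
    Integrable fun x : EuclideanSpace ℝ (Fin d) => heatKernelGrad t x := by
  refine ((integrable_heatKernel (d := d) (t := 2 * t) (by positivity)).const_mul
    (heatConst d * t ^ (-(1 / 2) : ℝ))).mono'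
    (measurable_heatKernelGrad.comp measurable_prodMk_left).aestronglyMeasurable
    (Eventually.of_forall (norm_heatKernelGrad_le ht))

lemma integral_norm_heatKernelGrad_le {t : ℝ} (ht : 0 < t) :
    ∫ x : EuclideanSpace ℝ (Fin d), ‖heatKernelGrad t x‖ ≤ heatConst d * t ^ (-(1 / 2) : ℝ) := by
  have h := integral_mono (integrable_heatKernelGrad (d := d) ht).norm
    ((integrable_heatKernel (d := d) (t := 2 * t) (by positivity)).const_mul
    (heatConst d * t ^ (-(1 / 2) : ℝ))) (norm_heatKernelGrad_le ht)
  rwa [integral_const_mul, integral_heatKernel (by positivity), mul_one] at h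

lemma integral_heatKernelGrad (t : ℝ) :
    ∫ x : EuclideanSpace ℝ (Fin d), heatKernelGrad t x = 0 := by
  have h := integral_neg_eq_self (fun x : EuclideanSpace ℝ (Fin d) => heatKernelGrad t x) volume
  simp_rw [heatKernelGrad_neg] at h
  rw [integral_neg] at h
  have h2 : (2 : ℝ) • ∫ x : EuclideanSpace ℝ (Fin d), heatKernelGrad t x = 0 := by
    rw [two_smul]
    nth_rw 1 [← h]
    exact neg_add_cancel _
  exact (smul_eq_zero.1 h2).resolve_left two_ne_zero

/-- The heat kernel is a Gaussian family: completing the square. -/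
lemma heatKernel_mul_heatKernel {s t : ℝ} (hs : 0 < s) (ht : 0 < t)
    (x z : EuclideanSpace ℝ (Fin d)) :
    heatKernel s (x - z) * heatKernel t z =
      heatKernel (s + t) x * heatKernel (s * t / (s + t)) (z - (t / (s + t)) • x) := by
  have h1 : (4 * Real.pi * s) ^ (-(d : ℝ) / 2) * (4 * Real.pi * t) ^ (-(d : ℝ) / 2) =
      (4 * Real.pi * (s + t)) ^ (-(d : ℝ) / 2) *
        (4 * Real.pi * (s * t / (s + t))) ^ (-(d : ℝ) / 2) := by
    rw [← Real.mul_rpow (by positivity) (by positivity),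
      ← Real.mul_rpow (by positivity) (by positivity)]
    congr 1
    field_simp
  have h2 : -‖x - z‖ ^ 2 / (4 * s) + -‖z‖ ^ 2 / (4 * t) =
      -‖x‖ ^ 2 / (4 * (s + t)) +
        -‖z - (t / (s + t)) • x‖ ^ 2 / (4 * (s * t / (s + t))) := by
    rw [norm_sub_sq_real, norm_sub_sq_real, norm_smul, inner_smul_right, real_inner_comm z x,
      Real.norm_eq_abs, abs_of_pos (by positivity)]
    field_simp
    ring
  unfold heatKernel
  calc _ = ((4 * Real.pi * s) ^ (-(d : ℝ) / 2) * (4 * Real.pi * t) ^ (-(d : ℝ) / 2)) *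
        Real.exp (-‖x - z‖ ^ 2 / (4 * s) + -‖z‖ ^ 2 / (4 * t)) := by rw [Real.exp_add]; ring
    _ = _ := by rw [h1, h2, Real.exp_add]; ring

lemma integral_heatKernel_conv {s t : ℝ} (hs : 0 < s) (ht : 0 < t)
    (x y : EuclideanSpace ℝ (Fin d)) :
    ∫ z, heatKernel s (x - z) * heatKernel t (z - y) = heatKernel (s + t) (x - y) := by
  have e := integral_sub_right_eq_self
    (fun z => heatKernel s (x - y - z) * heatKernel t z) (μ := volume) y
  simp only [sub_sub_sub_cancel_right] at e
  rw [e]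
  simp_rw [heatKernel_mul_heatKernel hs ht, integral_const_mul]
  rw [integral_sub_right_eq_self (fun z => heatKernel (s * t / (s + t)) z) (μ := volume),
    integral_heatKernel (by positivity), mul_one]

lemma integral_heatKernel_sub_smul {t : ℝ} (ht : 0 < t) (m : EuclideanSpace ℝ (Fin d)) :
    ∫ z, heatKernel t (z - m) • z = m := by
  have e1 : ∀ z : EuclideanSpace ℝ (Fin d), heatKernel t z • z =
      (-(2 * t)) • heatKernelGrad t z := by
    intro z
    rw [heatKernelGrad, smul_smul]
    congr 1
    field_simp
  have e := integral_sub_right_eq_self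
    (fun z => heatKernel t z • (z + m)) (μ := volume) m
  simp only [sub_add_cancel] at e
  rw [e]
  simp_rw [smul_add, e1]
  have i1 : Integrable fun z : EuclideanSpace ℝ (Fin d) => (-(2 * t)) • heatKernelGrad t z :=
    (integrable_heatKernelGrad ht).smul (-(2 * t))
  rw [integral_add i1 ((integrable_heatKernel ht).smul_const m), integral_smul,
    integral_heatKernelGrad,
    integral_smul_const, integral_heatKernel ht]
  simp

lemma integral_heatKernel_conv_grad {s t : ℝ} (hs : 0 < s) (ht : 0 < t)
    (x y : EuclideanSpace ℝ (Fin d)) :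
    ∫ z, heatKernel s (x - z) • heatKernelGrad t (z - y) = heatKernelGrad (s + t) (x - y) := by
  have e := integral_sub_right_eq_self
    (fun z => heatKernel s (x - y - z) • heatKernelGrad t z) (μ := volume) y
  simp only [sub_sub_sub_cancel_right] at e
  rw [e]
  have e1 : ∀ z : EuclideanSpace ℝ (Fin d), heatKernel s (x - y - z) • heatKernelGrad t z =
      (-(heatKernel (s + t) (x - y) / (2 * t))) •
        (heatKernel (s * t / (s + t)) (z - (t / (s + t)) • (x - y)) • z) := by
    intro z
    rw [heatKernelGrad, smul_smul, smul_smul]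
    congr 1
    have := heatKernel_mul_heatKernel hs ht (x - y) z
    calc _ = -(heatKernel s (x - y - z) * heatKernel t z) / (2 * t) := by ring
      _ = _ := by rw [this]; ring
  simp_rw [e1]
  rw [integral_smul, integral_heatKernel_sub_smul (by positivity), smul_smul, heatKernelGrad]
  congr 1
  field_simp

lemma norm_heatKernel_le {t : ℝ} (ht : 0 < t) (x : EuclideanSpace ℝ (Fin d)) :
    ‖heatKernel t x‖ ≤ (4 * Real.pi * t) ^ (-(d : ℝ) / 2) := by
  rw [Real.norm_of_nonneg (heatKernel_nonneg ht.le x), heatKernel]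
  refine mul_le_of_le_one_right (by positivity) ?_
  rw [Real.exp_le_one_iff, neg_div, neg_nonpos]
  positivity

lemma measurable_heatKernel_sub (t : ℝ) (x : EuclideanSpace ℝ (Fin d)) :
    Measurable fun z => heatKernel t (x - z) :=
  measurable_heatKernel.comp (f := fun z => (t, x - z)) (by fun_prop)

lemma integrable_heatKernel_mul {t : ℝ} (ht : 0 < t) {x : EuclideanSpace ℝ (Fin d)}
    {φ : EuclideanSpace ℝ (Fin d) → ℝ} (hφ : Integrable φ) :
    Integrable fun z => heatKernel t (x - z) * φ z :=
  hφ.bdd_mul (measurable_heatKernel_sub t x).aestronglyMeasurable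
    (Eventually.of_forall fun z => norm_heatKernel_le ht (x - z))

lemma integral_heatKernel_conv_inner {s t : ℝ} (hs : 0 < s) (ht : 0 < t)
    (x y b : EuclideanSpace ℝ (Fin d)) :
    ∫ z, heatKernel s (x - z) * inner ℝ (heatKernelGrad t (z - y)) b =
      inner ℝ (heatKernelGrad (s + t) (x - y)) b := by
  rw [← integral_heatKernel_conv_grad hs ht, real_inner_comm, ← integral_inner]
  · refine integral_congr_ae (Eventually.of_forall fun z => ?_)
    dsimp only
    rw [inner_smul_right, real_inner_comm]
  · exact ((integrable_heatKernelGrad ht).comp_sub_right y).bdd_smul _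
      (measurable_heatKernel_sub s x).aestronglyMeasurable
      (Eventually.of_forall fun z => norm_heatKernel_le hs (x - z))

/-- Since `t ^ (d / 2) K^t` increases with `t`, the heat kernel cannot decrease fast in time. -/
lemma heatKernel_sub_le {t h : ℝ} (ht : 0 < t) (hh : 0 ≤ h) (x : EuclideanSpace ℝ (Fin d)) :
    heatKernel t x - heatKernel (t + h) x ≤ d * (h / (t + h)) * heatKernel t x := by
  have hth : 0 < t + h := by positivity
  have h1 : (t / (t + h)) ^ ((d : ℝ) / 2) * heatKernel t x ≤ heatKernel (t + h) x := by
    unfold heatKernel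
    have e : (t / (t + h)) ^ ((d : ℝ) / 2) * (4 * Real.pi * t) ^ (-(d : ℝ) / 2) =
        (4 * Real.pi * (t + h)) ^ (-(d : ℝ) / 2) := by
      rw [show 4 * Real.pi * t = (t / (t + h)) * (4 * Real.pi * (t + h)) by field_simp,
        Real.mul_rpow (by positivity) (by positivity), ← mul_assoc,
        ← Real.rpow_add (by positivity)]
      simp [neg_div]
    rw [← mul_assoc, e]
    refine mul_le_mul_of_nonneg_left (Real.exp_le_exp.2 ?_) (by positivity)
    rw [neg_div, neg_div, neg_le_neg_iff]
    gcongr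
    linarith
  have h2 : 1 - d * (h / (t + h)) ≤ (t / (t + h)) ^ ((d : ℝ) / 2) := by
    have hle : t / (t + h) ≤ 1 := by rw [div_le_one hth]; linarith
    have hb := one_add_mul_le_pow (a := -(h / (t + h))) (by
      have : h / (t + h) ≤ 1 := by rw [div_le_one hth]; linarith
      linarith) d
    have e : 1 + -(h / (t + h)) = t / (t + h) := by field_simp; ring
    rw [e] at hb
    have := Real.rpow_le_rpow_of_exponent_ge (x := t / (t + h)) (y := d) (z := (d : ℝ) / 2)
      (by positivity) hle (by have : (0 : ℝ) ≤ d := d.cast_nonneg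
                              linarith)
    rw [Real.rpow_natCast] at this
    linarith
  have h3 := mul_le_mul_of_nonneg_right h2 (heatKernel_nonneg ht.le x)
  linarith

lemma div_add_le_rpow {t h p : ℝ} (ht : 0 < t) (hh : 0 ≤ h) (hp : 0 < p) (hp1 : p ≤ 1) :
    h / (t + h) ≤ (h / t) ^ p := by
  rcases hh.eq_or_lt with rfl | hh
  · simp [Real.zero_rpow hp.ne']
  have h1 : h / (t + h) ≤ 1 := by rw [div_le_one (by positivity)]; linarith
  calc h / (t + h) = (h / (t + h)) ^ (1 : ℝ) := (Real.rpow_one _).symm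
    _ ≤ (h / (t + h)) ^ p := Real.rpow_le_rpow_of_exponent_ge (by positivity) h1 hp1
    _ ≤ (h / t) ^ p := by
      refine Real.rpow_le_rpow (by positivity) ?_ hp.le
      gcongr
      linarith

lemma integral_abs_heatKernel_sub_le {t h p : ℝ} (ht : 0 < t) (hh : 0 ≤ h) (hp : 0 < p)
    (hp1 : p ≤ 1) :
    ∫ x : EuclideanSpace ℝ (Fin d), |heatKernel (t + h) x - heatKernel t x| ≤
      2 * d * (h / t) ^ p := by
  have i1 := integrable_heatKernel (d := d) ht
  have i2 := integrable_heatKernel (d := d) (t := t + h) (by positivity)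
  -- As `K^t` and `K^{t + h}` have equal mass, it suffices to bound the positive part of
  -- `K^t - K^{t + h}`.
  have h1 := integral_mono (i2.sub i1).abs (((i1.const_mul (2 * (d * (h / (t + h))))).sub
    (i1.sub i2))) (fun x => by
      have := heatKernel_sub_le ht hh x
      have h0 : 0 ≤ d * (h / (t + h)) * heatKernel t x :=
        mul_nonneg (by positivity) (heatKernel_nonneg ht.le x)
      simp only [Pi.sub_apply]
      rw [abs_le]
      constructor <;> linarith)
  simp only [Pi.sub_apply] at h1
  refine h1.trans ?_
  have i3 : Integrable fun x : EuclideanSpace ℝ (Fin d) =>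
      heatKernel t x - heatKernel (t + h) x := i1.sub i2
  rw [integral_sub (i1.const_mul _) i3, integral_const_mul, integral_sub i1 i2,
    integral_heatKernel ht, integral_heatKernel (by positivity)]
  have := mul_le_mul_of_nonneg_left (div_add_le_rpow ht hh hp hp1) (by positivity : 0 ≤ 2 * (d : ℝ))
  linarith

lemma integral_integral_conv_mul {a b : EuclideanSpace ℝ (Fin d) → ℝ} (ha : Integrable a)
    (hb : Integrable b) :
    (Integrable fun x => ∫ z, a (x - z) * b z) ∧
      ∫ x, ∫ z, a (x - z) * b z = (∫ x, a x) * ∫ x, b x := by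
  have h := integral_convolution (ContinuousLinearMap.mul ℝ ℝ) hb ha (μ := volume) (ν := volume)
  have h2 := hb.integrable_convolution (ContinuousLinearMap.mul ℝ ℝ) ha (μ := volume)
  have e : (convolution b a (ContinuousLinearMap.mul ℝ ℝ) volume) =
      fun x => ∫ z, a (x - z) * b z := by
    ext x
    simp [convolution, mul_comm]
  rw [e] at h h2
  refine ⟨h2, h.trans ?_⟩
  simp [mul_comm]

lemma integral_norm_heatKernelGrad_sub_le {t h : ℝ} (ht : 0 < t) (hh : 0 ≤ h) :
    ∫ x : EuclideanSpace ℝ (Fin d), ‖heatKernelGrad (t + h) x - heatKernelGrad t x‖ ≤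
      8 * d * heatConst d * (h ^ (1 / 4 : ℝ) * t ^ (-(3 / 4) : ℝ)) := by
  have ht2 : 0 < t / 2 := by positivity
  have ht2h : 0 < t / 2 + h := by positivity
  have i1 := integrable_heatKernel (d := d) ht2
  have i2 := integrable_heatKernel (d := d) ht2h
  have ig := integrable_heatKernelGrad (d := d) ht2
  set a : EuclideanSpace ℝ (Fin d) → ℝ := fun x => |heatKernel (t / 2 + h) x - heatKernel (t / 2) x|
  have ha : Integrable a := (i2.sub i1).abs
  obtain ⟨hc1, hc2⟩ := integral_integral_conv_mul ha ig.norm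
  -- Writing `∇K^{t + h} - ∇K^t` as `(K^{t/2 + h} - K^{t/2}) * ∇K^{t/2}`.
  have hpt : ∀ x : EuclideanSpace ℝ (Fin d), ‖heatKernelGrad (t + h) x - heatKernelGrad t x‖ ≤
      ∫ z, a (x - z) * ‖heatKernelGrad (t / 2) z‖ := by
    intro x
    have e1 := integral_heatKernel_conv_grad ht2h ht2 x 0
    have e2 := integral_heatKernel_conv_grad ht2 ht2 x 0
    simp only [sub_zero] at e1 e2
    rw [show t / 2 + h + t / 2 = t + h by ring] at e1
    rw [add_halves] at e2
    have j1 : ∀ s : ℝ, 0 < s → Integrable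
        (fun z => heatKernel s (x - z) • heatKernelGrad (t / 2) z) := fun s hs =>
      ig.bdd_smul _ (measurable_heatKernel_sub s x).aestronglyMeasurable
        (Eventually.of_forall fun z => norm_heatKernel_le hs (x - z))
    rw [← e1, ← e2, ← integral_sub (j1 _ ht2h) (j1 _ ht2)]
    refine (norm_integral_le_integral_norm _).trans (le_of_eq ?_)
    refine integral_congr_ae (Eventually.of_forall fun z => ?_)
    simp only [← sub_smul, norm_smul, Real.norm_eq_abs, a]
  have h1 := integral_mono ((integrable_heatKernelGrad (d := d) (t := t + h)
    (by positivity)).sub (integrable_heatKernelGrad ht)).norm hc1 hpt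
  refine h1.trans ?_
  rw [hc2]
  have b1 := integral_abs_heatKernel_sub_le (d := d) ht2 hh (p := 1 / 4) (by norm_num) (by norm_num)
  have b2 := integral_norm_heatKernelGrad_le (d := d) ht2
  have c1 : (h / (t / 2)) ^ (1 / 4 : ℝ) = h ^ (1 / 4 : ℝ) * (t / 2) ^ (-(1 / 4) : ℝ) := by
    rw [Real.div_rpow hh ht2.le, Real.rpow_neg ht2.le, div_eq_mul_inv]
  have c2 : (t / 2) ^ (-(1 / 4) : ℝ) * (t / 2) ^ (-(1 / 2) : ℝ) ≤ 2 * t ^ (-(3 / 4) : ℝ) := by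
    rw [← Real.rpow_add ht2, show (-(1 / 4) : ℝ) + -(1 / 2) = -(3 / 4) by norm_num,
      Real.div_rpow ht.le (by norm_num), div_eq_mul_inv, mul_comm, ← Real.rpow_neg (by norm_num)]
    gcongr
    calc (2 : ℝ) ^ (-(-(3 / 4)) : ℝ) ≤ 2 ^ (1 : ℝ) :=
          Real.rpow_le_rpow_of_exponent_le (by norm_num) (by norm_num)
      _ = 2 := Real.rpow_one _
  calc _ ≤ (2 * d * (h / (t / 2)) ^ (1 / 4 : ℝ)) * (heatConst d * (t / 2) ^ (-(1 / 2) : ℝ)) := by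
        refine mul_le_mul b1 b2 (integral_nonneg fun _ => norm_nonneg _) (by positivity)
    _ = 2 * d * heatConst d * h ^ (1 / 4 : ℝ) *
          ((t / 2) ^ (-(1 / 4) : ℝ) * (t / 2) ^ (-(1 / 2) : ℝ)) := by rw [c1]; ring
    _ ≤ 2 * d * heatConst d * h ^ (1 / 4 : ℝ) * (2 * t ^ (-(3 / 4) : ℝ)) := by
        have := heatConst_pos d
        gcongr
    _ ≤ _ := by
        have := heatConst_pos d
        have h0 : 0 ≤ d * heatConst d * (h ^ (1 / 4 : ℝ) * t ^ (-(3 / 4) : ℝ)) := by positivity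
        linarith

end HeatKernel

/-! ### Periodic fluxes -/

section Flux

variable {d : ℕ} {V : Type*} [NormedAddCommGroup V]

/-- A jointly continuous function that is periodic in `x` is bounded for bounded `u`. -/
lemma exists_bound_of_periodic {T : Fin d → ℝ} (hT : ∀ i, 0 < T i)
    {F : ℝ → EuclideanSpace ℝ (Fin d) → V}
    (hF : Continuous fun p : ℝ × EuclideanSpace ℝ (Fin d) => F p.1 p.2)
    (hper : ∀ (i : Fin d) (u : ℝ) (x : EuclideanSpace ℝ (Fin d)),
      F u (x + EuclideanSpace.single i (T i)) = F u x) (R : ℝ) :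
    ∃ C, ∀ u ∈ Icc (-R) R, ∀ x, ‖F u x‖ ≤ C := by
  set B : Set (EuclideanSpace ℝ (Fin d)) :=
    (WithLp.toLp 2) '' (Set.pi univ fun i : Fin d => Icc 0 (T i)) with hB
  have hBc : IsCompact B :=
    (isCompact_univ_pi fun i => isCompact_Icc).image (PiLp.continuous_toLp 2 _)
  obtain ⟨C, hC⟩ := ((isCompact_Icc (a := -R) (b := R)).prod hBc).exists_bound_of_continuousOn
    hF.continuousOn
  refine ⟨C, fun u hu x => ?_⟩
  have hsum : ∀ (n : Fin d → ℤ) (s : Finset (Fin d)),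
      Function.Periodic (F u) (∑ i ∈ s, n i • EuclideanSpace.single i (T i)) := by
    intro n s
    induction s using Finset.induction_on with
    | empty => intro y; simp
    | insert i s hi ih =>
      rw [Finset.sum_insert hi]
      exact (Function.Periodic.zsmul (fun y => hper i u y) (n i)).add_period ih
  set n : Fin d → ℤ := fun i => -⌊x i / T i⌋ with hn
  set x' := x + ∑ i, n i • EuclideanSpace.single i (T i) with hx'
  have h1 : F u x' = F u x := hsum n Finset.univ x
  have hx'i : ∀ i, x' i = x i - ⌊x i / T i⌋ * T i := by
    intro i
    simp [hx', hn, Finset.sum_apply, Pi.single_apply]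
    ring
  have h2 : x' ∈ B := by
    refine ⟨fun i => x' i, fun i _ => ?_, rfl⟩
    have hi := hT i
    have a1 := Int.floor_le (x i / T i)
    have a2 := (Int.lt_floor_add_one (x i / T i)).le
    rw [le_div_iff₀ hi] at a1
    rw [div_le_iff₀ hi] at a2
    simp only [mem_Icc, hx'i]
    constructor <;> linarith
  rw [← h1]
  exact hC (u, x') ⟨hu, h2⟩

variable {f : ℝ → EuclideanSpace ℝ (Fin d) → EuclideanSpace ℝ (Fin d)} {T : Fin d → ℝ}

lemma IsC2C1Flux.continuous (hf : IsC2C1Flux f) :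
    Continuous fun p : ℝ × EuclideanSpace ℝ (Fin d) => f p.1 p.2 := by
  simpa using hf.continuous_deriv 0 (by norm_num)

lemma IsC2C1Flux.exists_bound (hf : IsC2C1Flux f) (hT : ∀ i, 0 < T i) (hper : IsPeriodicFlux T f)
    (R : ℝ) : ∃ C, ∀ u ∈ Icc (-R) R, ∀ x, ‖f u x‖ ≤ C :=
  exists_bound_of_periodic hT hf.continuous hper R

lemma IsC2C1Flux.exists_deriv_bound (hf : IsC2C1Flux f) (hT : ∀ i, 0 < T i)
    (hper : IsPeriodicFlux T f) (R : ℝ) :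
    ∃ C, ∀ u ∈ Icc (-R) R, ∀ x, ‖deriv (fun w => f w x) u‖ ≤ C := by
  have hc := hf.continuous_deriv 1 (by norm_num)
  simp only [iteratedDeriv_one] at hc
  refine exists_bound_of_periodic (F := fun u x => deriv (fun w => f w x) u) hT hc
    (fun i u x => ?_) R
  have : (fun w => f w (x + EuclideanSpace.single i (T i))) = fun w => f w x :=
    funext fun w => hper i w x
  simp only [this]

lemma IsC2C1Flux.lipschitz (hf : IsC2C1Flux f) {s : Set ℝ} (hs : Convex ℝ s) {L : ℝ}
    (hL : ∀ u ∈ s, ∀ x, ‖deriv (fun w => f w x) u‖ ≤ L) {a b : ℝ} (ha : a ∈ s) (hb : b ∈ s)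
    (x : EuclideanSpace ℝ (Fin d)) : ‖f a x - f b x‖ ≤ L * |a - b| :=
  hs.norm_image_sub_le_of_norm_deriv_le (f := fun w => f w x)
    (fun u _ => ((hf.contDiff_left x).differentiable (by norm_num)) u) (fun u hu => hL u hu x) hb ha

/-- Truncation of a real number to `[-R, R]`. -/
def truncate (R r : ℝ) : ℝ := max (-R) (min R r)

lemma truncate_mem {R : ℝ} (hR : 0 ≤ R) (r : ℝ) : truncate R r ∈ Icc (-R) R :=
  ⟨le_max_left _ _, max_le (by linarith) (min_le_left _ _)⟩

lemma truncate_eq_self {R r : ℝ} (h : |r| ≤ R) : truncate R r = r := by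
  rw [abs_le] at h
  rw [truncate, min_eq_right h.2, max_eq_right h.1]

lemma abs_truncate_sub_le (R r r' : ℝ) : |truncate R r - truncate R r'| ≤ |r - r'| := by
  unfold truncate
  refine (abs_max_sub_max_le_max _ _ _ _).trans ?_
  rw [sub_self, abs_zero]
  refine max_le (abs_nonneg _) ((abs_min_sub_min_le_max _ _ _ _).trans ?_)
  simp

lemma measurable_truncate (R : ℝ) : Measurable (truncate R) := by
  unfold truncate; fun_prop

end Flux

/-! ### Mild solutions as fixed points -/

section Mild

variable {d : ℕ} {f φ : ℝ → EuclideanSpace ℝ (Fin d) → EuclideanSpace ℝ (Fin d)}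
  {u₀ v₀ : EuclideanSpace ℝ (Fin d) → ℝ} {u v : ℝ → EuclideanSpace ℝ (Fin d) → ℝ}

/-- The solution `K^t * u₀` of the heat equation, extended by `0` to `t ≤ 0`. -/
noncomputable def heatFlow (u₀ : EuclideanSpace ℝ (Fin d) → ℝ) (t : ℝ)
    (x : EuclideanSpace ℝ (Fin d)) : ℝ :=
  (Ioi (0 : ℝ)).indicator (fun t => ∫ y, heatKernel t (x - y) * u₀ y) t

lemma heatFlow_of_pos {t : ℝ} (ht : 0 < t) (x : EuclideanSpace ℝ (Fin d)) :
    heatFlow u₀ t x = ∫ y, heatKernel t (x - y) * u₀ y := by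
  rw [heatFlow, indicator_of_mem (mem_Ioi.2 ht)]

lemma heatFlow_of_nonpos {t : ℝ} (ht : t ≤ 0) (x : EuclideanSpace ℝ (Fin d)) :
    heatFlow u₀ t x = 0 := by
  rw [heatFlow, indicator_of_notMem (by simpa using ht)]

lemma measurable_heatFlow (h : Measurable u₀) : Measurable (Function.uncurry (heatFlow u₀)) := by
  have h1 : Measurable fun q : (ℝ × EuclideanSpace ℝ (Fin d)) × EuclideanSpace ℝ (Fin d) =>
      heatKernel q.1.1 (q.1.2 - q.2) * u₀ q.2 :=
    (measurable_heatKernel.comp (f := fun q : (ℝ × EuclideanSpace ℝ (Fin d)) ×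
      EuclideanSpace ℝ (Fin d) => (q.1.1, q.1.2 - q.2)) (by fun_prop)).mul (h.comp measurable_snd)
  have h2 := h1.stronglyMeasurable.integral_prod_right' (ν := volume)
  exact h2.measurable.indicator (measurableSet_lt measurable_const measurable_fst)

lemma integrable_heatKernel_sub {t : ℝ} (ht : 0 < t) (x : EuclideanSpace ℝ (Fin d)) :
    Integrable fun y => heatKernel t (x - y) :=
  (integrable_heatKernel ht).comp_sub_left x

lemma integral_heatKernel_sub {t : ℝ} (ht : 0 < t) (x : EuclideanSpace ℝ (Fin d)) :
    ∫ y, heatKernel t (x - y) = 1 := by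
  rw [integral_sub_left_eq_self (fun y => heatKernel t y), integral_heatKernel ht]

lemma abs_heatFlow_le {G : ℝ} (hG : ∀ x, |u₀ x| ≤ G) (t : ℝ)
    (x : EuclideanSpace ℝ (Fin d)) : |heatFlow u₀ t x| ≤ G := by
  rcases le_or_gt t 0 with ht | ht
  · rw [heatFlow_of_nonpos ht, abs_zero]
    exact (abs_nonneg _).trans (hG x)
  · rw [heatFlow_of_pos ht]
    have := norm_integral_le_of_norm_le (f := fun y => heatKernel t (x - y) * u₀ y)
      ((integrable_heatKernel_sub ht x).mul_const G)
      (Eventually.of_forall fun y => by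
        rw [norm_mul, Real.norm_of_nonneg (heatKernel_nonneg ht.le _)]
        exact mul_le_mul_of_nonneg_left (hG y) (heatKernel_nonneg ht.le _))
    rwa [integral_mul_const, integral_heatKernel_sub ht, one_mul] at this

lemma exists_bounded_version (h : MemLp u₀ ⊤ volume) :
    ∃ w : EuclideanSpace ℝ (Fin d) → ℝ, Measurable w ∧ (∃ G, ∀ x, |w x| ≤ G) ∧
      u₀ =ᵐ[volume] w := by
  set G := (eLpNormEssSup u₀ volume).toReal with hG
  have hfin : eLpNormEssSup u₀ volume < ⊤ := by
    have := h.2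
    rwa [eLpNorm_exponent_top] at this
  have hb : ∀ᵐ x, |u₀ x| ≤ G := by
    filter_upwards [ae_le_eLpNormEssSup (f := u₀) (μ := volume)] with x hx
    have := ENNReal.toReal_mono hfin.ne hx
    simpa using this
  refine ⟨fun x => truncate G (h.1.mk u₀ x),
    (measurable_truncate G).comp h.1.stronglyMeasurable_mk.measurable, ⟨G, fun x => ?_⟩, ?_⟩
  · exact abs_le.2 (truncate_mem ENNReal.toReal_nonneg _)
  · filter_upwards [h.1.ae_eq_mk, hb] with x hx hx2
    rw [← hx, truncate_eq_self hx2]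

/-- The integrand of Duhamel's formula for the flux `φ`. -/
noncomputable def duhamelKernel (φ : ℝ → EuclideanSpace ℝ (Fin d) → EuclideanSpace ℝ (Fin d))
    (t s : ℝ) (x y : EuclideanSpace ℝ (Fin d)) (r : ℝ) : ℝ :=
  -inner ℝ (heatKernelGrad (t - s) (x - y)) (φ r y)

lemma measurable_duhamelKernel
    (hφ : Measurable fun p : ℝ × EuclideanSpace ℝ (Fin d) => φ p.1 p.2) :
    Measurable fun p : (ℝ × ℝ) × (EuclideanSpace ℝ (Fin d) × EuclideanSpace ℝ (Fin d)) × ℝ =>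
      duhamelKernel φ p.1.1 p.1.2 p.2.1.1 p.2.1.2 p.2.2 := by
  unfold duhamelKernel
  refine (Measurable.inner ?_ ?_).neg
  · exact measurable_heatKernelGrad.comp (f := fun p : (ℝ × ℝ) × (EuclideanSpace ℝ (Fin d) ×
      EuclideanSpace ℝ (Fin d)) × ℝ => (p.1.1 - p.1.2, p.2.1.1 - p.2.1.2)) (by fun_prop)
  · exact hφ.comp (f := fun p : (ℝ × ℝ) × (EuclideanSpace ℝ (Fin d) ×
      EuclideanSpace ℝ (Fin d)) × ℝ => (p.2.2, p.2.1.2)) (by fun_prop)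

lemma integrable_heatKernelGrad_sub {t : ℝ} (ht : 0 < t) (x : EuclideanSpace ℝ (Fin d)) :
    Integrable fun y => heatKernelGrad t (x - y) :=
  (integrable_heatKernelGrad ht).comp_sub_left x

lemma integral_norm_heatKernelGrad_comp_sub_le {t : ℝ} (ht : 0 < t) (x : EuclideanSpace ℝ (Fin d)) :
    ∫ y, ‖heatKernelGrad t (x - y)‖ ≤ heatConst d * t ^ (-(1 / 2) : ℝ) := by
  rw [integral_sub_left_eq_self (fun y => ‖heatKernelGrad t y‖)]
  exact integral_norm_heatKernelGrad_le ht

lemma isLipschitzVolterra_duhamelKernel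
    (hφ : Measurable fun p : ℝ × EuclideanSpace ℝ (Fin d) => φ p.1 p.2) {L B : ℝ} (hL : 0 < L)
    (hB : 0 ≤ B) (hφB : ∀ x, ‖φ 0 x‖ ≤ B) (hφL : ∀ r r' x, ‖φ r x - φ r' x‖ ≤ L * |r - r'|) :
    IsLipschitzVolterra (volume : Measure (EuclideanSpace ℝ (Fin d))) (duhamelKernel φ)
      (L * heatConst d) (B / L) where
  nonneg_left := mul_nonneg hL.le (heatConst_pos d).le
  nonneg_right := by positivity
  measurable := measurable_duhamelKernel hφ
  dominated t s x _ hst := by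
    have hts : 0 < t - s := sub_pos.2 hst
    refine ⟨fun y => L * ‖heatKernelGrad (t - s) (x - y)‖,
      (integrable_heatKernelGrad_sub hts x).norm.const_mul L, ?_, fun y => ⟨?_, fun r r' => ?_⟩⟩
    · rw [integral_const_mul, mul_assoc]
      exact mul_le_mul_of_nonneg_left (integral_norm_heatKernelGrad_comp_sub_le hts x) hL.le
    · rw [duhamelKernel, abs_neg]
      refine (abs_real_inner_le_norm _ _).trans ?_
      calc _ ≤ ‖heatKernelGrad (t - s) (x - y)‖ * B := by gcongr; exact hφB y
        _ = _ := by field_simp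
    · rw [duhamelKernel, duhamelKernel, neg_sub_neg, ← inner_sub_right]
      refine (abs_real_inner_le_norm _ _).trans ?_
      calc _ ≤ ‖heatKernelGrad (t - s) (x - y)‖ * (L * |r' - r|) := by gcongr; exact hφL r' r y
        _ = _ := by rw [abs_sub_comm]; ring

lemma duhamel_eq_volterra {t : ℝ} (ht : 0 < t) (x : EuclideanSpace ℝ (Fin d)) :
    (∫ y, heatKernel t (x - y) * u₀ y) -
      ∫ s in (0 : ℝ)..t, ∫ y, inner ℝ (gradient (heatKernel (t - s)) (x - y)) (f (u s y) y) =
    volterra volume (heatFlow u₀) (duhamelKernel f) u t x := by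
  rw [volterra, heatFlow_of_pos ht, sub_eq_add_neg, intervalIntegral.integral_of_le ht.le,
    integral_Ioc_eq_integral_Ioo, ← integral_neg]
  simp only [duhamelKernel, gradient_heatKernel, integral_neg]

lemma volterra_congr {N : ℝ → ℝ → EuclideanSpace ℝ (Fin d) → EuclideanSpace ℝ (Fin d) → ℝ → ℝ}
    {N' : ℝ → ℝ → EuclideanSpace ℝ (Fin d) → EuclideanSpace ℝ (Fin d) → ℝ → ℝ}
    {g : ℝ → EuclideanSpace ℝ (Fin d) → ℝ} {t : ℝ} {x : EuclideanSpace ℝ (Fin d)}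
    (h : ∀ s ∈ Ioo 0 t, ∀ y, N t s x y (u s y) = N' t s x y (v s y)) :
    volterra volume g N u t x = volterra volume g N' v t x := by
  unfold volterra
  congr 1
  refine setIntegral_congr_fun measurableSet_Ioo fun s hs => ?_
  simp only [h s hs]

/-- A mild solution coincides at positive times with a measurable function: the right-hand side of
Duhamel's formula depends measurably on `(t, x)`, and only on the class of `u` almost
everywhere. -/
lemma IsMildSolution.exists_measurable
    (hf : Continuous fun p : ℝ × EuclideanSpace ℝ (Fin d) => f p.1 p.2) (hu₀ : Measurable u₀)
    (hu : IsMildSolution f u₀ u) :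
    ∃ w : ℝ → EuclideanSpace ℝ (Fin d) → ℝ, Measurable (Function.uncurry w) ∧
      (∀ t > 0, ∀ x, w t x = u t x) ∧
      ∀ t > 0, ∀ x, w t x = volterra volume (heatFlow u₀) (duhamelKernel f) w t x := by
  set w₁ : ℝ → EuclideanSpace ℝ (Fin d) → ℝ :=
    fun t x => hu.aestronglyMeasurable.mk (Function.uncurry u) (t, x) with hw₁
  have hw₁m : Measurable (Function.uncurry w₁) :=
    hu.aestronglyMeasurable.stronglyMeasurable_mk.measurable
  have hae := Measure.ae_ae_of_ae_prod hu.aestronglyMeasurable.ae_eq_mk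
  have key : ∀ t > 0, ∀ x, volterra volume (heatFlow u₀) (duhamelKernel f) w₁ t x = u t x := by
    intro t ht x
    rw [hu.duhamel t ht x, duhamel_eq_volterra ht]
    unfold volterra
    congr 1
    refine integral_congr_ae ?_
    filter_upwards [ae_restrict_of_ae_restrict_of_subset Ioo_subset_Ioi_self hae] with s hs
    refine integral_congr_ae ?_
    filter_upwards [hs] with y hy
    have : w₁ s y = u s y := hy.symm
    rw [this]
  refine ⟨volterra volume (heatFlow u₀) (duhamelKernel f) w₁,
    measurable_volterra (measurable_duhamelKernel hf.measurable) (measurable_heatFlow hu₀) hw₁m,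
    key, fun t ht x => ?_⟩
  rw [key t ht x, hu.duhamel t ht x, duhamel_eq_volterra ht]
  exact volterra_congr fun s hs y => by rw [key s hs.1 y]

lemma IsMildSolution.congr_ae (h : u₀ =ᵐ[volume] v₀) (hu : IsMildSolution f u₀ u) :
    IsMildSolution f v₀ u := by
  refine ⟨hu.1, hu.2, fun t ht x => ?_⟩
  rw [hu.3 t ht x]
  congr 1
  refine integral_congr_ae ?_
  filter_upwards [h] with y hy
  rw [hy]

lemma IsMildSolution.unique (hf : IsC2C1Flux f) {T : Fin d → ℝ} (hT : ∀ i, 0 < T i)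
    (hper : IsPeriodicFlux T f) (hu₀ : MemLp u₀ ⊤ volume) (hu : IsMildSolution f u₀ u)
    (hv : IsMildSolution f u₀ v) {t : ℝ} (ht : 0 < t) : u t = v t := by
  obtain ⟨w₀, hw₀, -, hw₀u⟩ := exists_bounded_version hu₀
  obtain ⟨u', hu'm, hu'u, hu'⟩ := (hu.congr_ae hw₀u).exists_measurable hf.continuous hw₀
  obtain ⟨v', hv'm, hv'v, hv'⟩ := (hv.congr_ae hw₀u).exists_measurable hf.continuous hw₀
  obtain ⟨C₁, hC₁⟩ := hu.bounded t
  obtain ⟨C₂, hC₂⟩ := hv.bounded t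
  set R := max (max C₁ C₂) 0
  have hR : 0 ≤ R := le_max_right _ _
  have hu'R : ∀ s ∈ Ioc 0 t, ∀ y, |u' s y| ≤ R := fun s hs y => by
    rw [hu'u s hs.1]
    exact (hC₁ s hs y).trans ((le_max_left _ _).trans (le_max_left _ _))
  have hv'R : ∀ s ∈ Ioc 0 t, ∀ y, |v' s y| ≤ R := fun s hs y => by
    rw [hv'v s hs.1]
    exact (hC₂ s hs y).trans ((le_max_right _ _).trans (le_max_left _ _))
  obtain ⟨L, hL⟩ := hf.exists_deriv_bound hT hper R
  obtain ⟨B, hB⟩ := hf.exists_bound hT hper R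
  -- Both solutions stay in `[-R, R]`, where the truncation of the flux is not felt.
  have hN := isLipschitzVolterra_duhamelKernel (φ := fun r y => f (truncate R r) y)
    (L := |L| + 1) (B := |B|)
    (hf.continuous.measurable.comp
      (f := fun p : ℝ × EuclideanSpace ℝ (Fin d) => (truncate R p.1, p.2))
      (((measurable_truncate R).comp measurable_fst).prodMk measurable_snd)) (by positivity)
    (by positivity)
    (fun x => (hB _ (truncate_mem hR 0) x).trans (le_abs_self B))
    (fun r r' x => by
      refine (hf.lipschitz (convex_Icc _ _) hL (truncate_mem hR r) (truncate_mem hR r') x).trans ?_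
      have h1 := abs_truncate_sub_le R r r'
      have h2 : L ≤ |L| + 1 := (le_abs_self L).trans (by linarith)
      exact mul_le_mul h2 h1 (abs_nonneg _) (by positivity))
  ext x
  rw [← hu'u t ht, ← hv'v t ht]
  refine hN.eq_of_fixed (g := heatFlow w₀) hu'm hv'm hu'R hv'R (fun s hs y => ?_)
    (fun s hs y => ?_) t ⟨ht, le_rfl⟩ x
  · rw [hu' s hs.1]
    refine volterra_congr fun r hr z => ?_
    rw [duhamelKernel, duhamelKernel, truncate_eq_self (hu'R r ⟨hr.1, hr.2.le.trans hs.2⟩ z)]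
  · rw [hv' s hs.1]
    refine volterra_congr fun r hr z => ?_
    rw [duhamelKernel, duhamelKernel, truncate_eq_self (hv'R r ⟨hr.1, hr.2.le.trans hs.2⟩ z)]

lemma exists_isMildSolution (hf : IsC2C1Flux f) {T : Fin d → ℝ} (hT : ∀ i, 0 < T i)
    (hper : IsPeriodicFlux T f) {M : ℝ}
    (hM : ∀ (u : ℝ) (x : EuclideanSpace ℝ (Fin d)), ‖deriv (fun w => f w x) u‖ ≤ M)
    (hu₀ : MemLp u₀ ⊤ volume) : ∃ u, IsMildSolution f u₀ u := by
  obtain ⟨w₀, hw₀, ⟨G, hG⟩, hw₀u⟩ := exists_bounded_version hu₀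
  obtain ⟨B, hB⟩ := hf.exists_bound hT hper 0
  have hN := isLipschitzVolterra_duhamelKernel (φ := f) (L := |M| + 1) (B := |B|)
    hf.continuous.measurable (by positivity) (by positivity)
    (fun x => (hB 0 (by simp) x).trans (le_abs_self B))
    (fun r r' x => by
      refine (hf.lipschitz convex_univ (fun u _ x => hM u x) (mem_univ r) (mem_univ r') x).trans ?_
      have h2 : M ≤ |M| + 1 := (le_abs_self M).trans (by linarith)
      gcongr)
  obtain ⟨-, u, hum, -, hub, hu⟩ :=
    hN.exists_fixed (measurable_heatFlow hw₀) (abs_heatFlow_le hG)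
  refine ⟨u, IsMildSolution.congr_ae hw₀u.symm ⟨hum.aestronglyMeasurable, hub, fun t ht x => ?_⟩⟩
  rw [hu t ht x, duhamel_eq_volterra ht]

lemma nonlinearSemigroup_eq (hf : IsC2C1Flux f) {T : Fin d → ℝ} (hT : ∀ i, 0 < T i)
    (hper : IsPeriodicFlux T f) (hu₀ : MemLp u₀ ⊤ volume) (hu : IsMildSolution f u₀ u) {t : ℝ}
    (ht : 0 < t) : nonlinearSemigroup f t u₀ = u t := by
  have h : ∃ u, IsMildSolution f u₀ u := ⟨u, hu⟩
  rw [nonlinearSemigroup, dif_pos h]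
  exact h.choose_spec.unique hf hT hper hu₀ hu ht

end Mild

/-! ### Fubini's theorem on a product of three spaces -/

section Fubini

variable {X Y Z : Type*} [MeasurableSpace X] [MeasurableSpace Y] [MeasurableSpace Z]
  {μ : Measure X} {ν : Measure Y} {τ : Measure Z} [SFinite ν]

lemma integrable_prod_of_lintegral_ne_top {F : X × Y → ℝ} (hF : Measurable F)
    (h : ∫⁻ x, ∫⁻ y, ‖F (x, y)‖ₑ ∂ν ∂μ ≠ ⊤) : Integrable F (μ.prod ν) := by
  refine ⟨hF.aestronglyMeasurable, ?_⟩
  rw [hasFiniteIntegral_iff_enorm, lintegral_prod _ hF.enorm.aemeasurable]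
  exact lt_top_iff_ne_top.2 h

variable [SFinite μ] [SFinite τ]

lemma lintegral_triple_swap {F : X × (Z × Y) → ENNReal} (hF : Measurable F) :
    ∫⁻ x, ∫⁻ s, ∫⁻ y, F (x, s, y) ∂ν ∂τ ∂μ = ∫⁻ s, ∫⁻ y, ∫⁻ x, F (x, s, y) ∂μ ∂ν ∂τ := by
  calc _ = ∫⁻ x, ∫⁻ p, F (x, p) ∂(τ.prod ν) ∂μ := by
        refine lintegral_congr fun x => ?_
        exact (lintegral_prod _ (hF.comp measurable_prodMk_left).aemeasurable).symm
    _ = ∫⁻ p, ∫⁻ x, F (x, p) ∂μ ∂(τ.prod ν) :=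
        lintegral_lintegral_swap (f := fun x p => F (x, p)) hF.aemeasurable
    _ = _ := lintegral_prod _ (Measurable.lintegral_prod_left' hF).aemeasurable

lemma integral_triple_swap {F : X × (Z × Y) → ℝ} (hF : Measurable F)
    (h : ∫⁻ x, ∫⁻ s, ∫⁻ y, ‖F (x, s, y)‖ₑ ∂ν ∂τ ∂μ ≠ ⊤) :
    Integrable (fun x => ∫ s, ∫ y, F (x, s, y) ∂ν ∂τ) μ ∧
      ∫ x, ∫ s, ∫ y, F (x, s, y) ∂ν ∂τ ∂μ = ∫ s, ∫ y, ∫ x, F (x, s, y) ∂μ ∂ν ∂τ := by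
  have hI : Integrable F (μ.prod (τ.prod ν)) := by
    refine integrable_prod_of_lintegral_ne_top hF ?_
    convert h using 3 with x
    exact lintegral_prod _ (hF.comp measurable_prodMk_left).enorm.aemeasurable
  have hae : (fun x => ∫ s, ∫ y, F (x, s, y) ∂ν ∂τ) =ᵐ[μ] fun x => ∫ p, F (x, p) ∂(τ.prod ν) := by
    filter_upwards [hI.prod_right_ae] with x hx
    exact (integral_prod _ hx).symm
  refine ⟨hI.integral_prod_left.congr hae.symm, ?_⟩
  rw [integral_congr_ae hae, integral_integral_swap (f := fun x p => F (x, p)) hI]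
  exact integral_prod _ hI.swap.integral_prod_left

end Fubini

/-! ### Positive approximations of a drift -/

section Drift

variable {d : ℕ} {lam δ M : ℝ}

/-- The kernel of `K^τ * B`, where `B` is the operator with kernel
`lam K^{2δ}(x - y) - ∇K^δ(x - y) ⬝ c(y)`: up to `lam` times the identity, `B` approximates
the drift `-div (c ⬝)`, and `B` is positive if `lam` is large. -/
noncomputable def driftKernel (lam δ τ : ℝ) (c z : EuclideanSpace ℝ (Fin d)) : ℝ :=
  lam * heatKernel (τ + 2 * δ) z - inner ℝ (heatKernelGrad (τ + δ) z) c

lemma measurable_driftKernel (lam δ : ℝ) : Measurable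
    fun p : ℝ × EuclideanSpace ℝ (Fin d) × EuclideanSpace ℝ (Fin d) =>
      driftKernel lam δ p.1 p.2.1 p.2.2 := by
  unfold driftKernel
  refine Measurable.sub ?_ (Measurable.inner ?_ (by fun_prop))
  · exact (measurable_heatKernel.comp (f := fun p : ℝ × EuclideanSpace ℝ (Fin d) ×
      EuclideanSpace ℝ (Fin d) => (p.1 + 2 * δ, p.2.2)) (by fun_prop)).const_mul lam
  · exact measurable_heatKernelGrad.comp (f := fun p : ℝ × EuclideanSpace ℝ (Fin d) ×
      EuclideanSpace ℝ (Fin d) => (p.1 + δ, p.2.2)) (by fun_prop)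

lemma integrable_driftKernel (lam : ℝ) {τ : ℝ} (hδ : 0 < δ) (hτ : 0 ≤ τ)
    (c : EuclideanSpace ℝ (Fin d)) :
    Integrable fun z => driftKernel lam δ τ c z := by
  refine ((integrable_heatKernel (by positivity)).const_mul lam).sub ?_
  simp_rw [real_inner_comm c]
  exact (integrable_heatKernelGrad (by positivity)).const_inner c

lemma integral_driftKernel (lam : ℝ) {τ : ℝ} (hδ : 0 < δ) (hτ : 0 ≤ τ)
    (c : EuclideanSpace ℝ (Fin d)) : ∫ z, driftKernel lam δ τ c z = lam := by
  have hg : Integrable fun z : EuclideanSpace ℝ (Fin d) => heatKernelGrad (τ + δ) z :=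
    integrable_heatKernelGrad (by positivity)
  unfold driftKernel
  simp_rw [real_inner_comm c]
  rw [integral_sub ((integrable_heatKernel (by positivity)).const_mul lam) (hg.const_inner c),
    integral_const_mul, integral_heatKernel (by positivity), integral_inner hg,
    integral_heatKernelGrad]
  simp

lemma integral_heatKernel_conv_driftKernel (lam : ℝ) {σ τ : ℝ} (hδ : 0 < δ) (hσ : 0 < σ)
    (hτ : 0 ≤ τ) (x y c : EuclideanSpace ℝ (Fin d)) :
    ∫ z, heatKernel σ (x - z) * driftKernel lam δ τ c (z - y) =
      driftKernel lam δ (σ + τ) c (x - y) := by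
  have h1 : Integrable fun z => heatKernel σ (x - z) * heatKernel (τ + 2 * δ) (z - y) :=
    integrable_heatKernel_mul hσ ((integrable_heatKernel (by positivity)).comp_sub_right y)
  have h2 : Integrable fun z =>
      heatKernel σ (x - z) * inner ℝ (heatKernelGrad (τ + δ) (z - y)) c := by
    refine integrable_heatKernel_mul hσ ?_
    simp_rw [real_inner_comm c]
    exact ((integrable_heatKernelGrad (by positivity)).comp_sub_right y).const_inner c
  have e : ∀ z, heatKernel σ (x - z) * driftKernel lam δ τ c (z - y) =
      lam * (heatKernel σ (x - z) * heatKernel (τ + 2 * δ) (z - y)) -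
        heatKernel σ (x - z) * inner ℝ (heatKernelGrad (τ + δ) (z - y)) c := fun z => by
    unfold driftKernel; ring
  simp_rw [e]
  rw [integral_sub (h1.const_mul lam) h2, integral_const_mul,
    integral_heatKernel_conv hσ (by positivity), integral_heatKernel_conv_inner hσ (by positivity),
    driftKernel, add_assoc, add_assoc]

/-- The Gaussian bound on `∇K^δ` makes the kernel of `B` nonnegative. -/
lemma driftKernel_nonneg (hδ : 0 < δ)
    (hlam : M * heatConst d * δ ^ (-(1 / 2) : ℝ) ≤ lam) {τ : ℝ} (hτ : 0 ≤ τ)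
    {c : EuclideanSpace ℝ (Fin d)} (hc : ‖c‖ ≤ M) (z : EuclideanSpace ℝ (Fin d)) :
    0 ≤ driftKernel lam δ τ c z := by
  have h0 : ∀ z, 0 ≤ driftKernel lam δ 0 c z := by
    intro z
    have hK := heatKernel_nonneg (t := 2 * δ) (by positivity) z
    have h1 : inner ℝ (heatKernelGrad δ z) c ≤
        heatConst d * δ ^ (-(1 / 2) : ℝ) * heatKernel (2 * δ) z * M :=
      (real_inner_le_norm _ _).trans (mul_le_mul (norm_heatKernelGrad_le hδ z) hc (norm_nonneg _)
        (mul_nonneg (mul_nonneg (heatConst_pos d).le (by positivity)) hK))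
    have h2 := mul_le_mul_of_nonneg_right hlam hK
    rw [driftKernel, zero_add, zero_add]
    linarith
  rcases hτ.eq_or_lt with rfl | hτ
  · exact h0 z
  · have := integral_heatKernel_conv_driftKernel lam hδ hτ le_rfl z 0 c
    rw [add_zero, sub_zero] at this
    rw [← this]
    exact integral_nonneg fun y => mul_nonneg (heatKernel_nonneg hτ.le _) (h0 _)

lemma driftKernel_bound (hδ : 0 < δ) (hM : 0 ≤ M) (hlam : 0 ≤ lam) {τ : ℝ} (hτ : 0 < τ)
    (x : EuclideanSpace ℝ (Fin d)) : ∃ Q : EuclideanSpace ℝ (Fin d) → ℝ, Integrable Q ∧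
      ∫ y, Q y ≤ lam + M * heatConst d * τ ^ (-(1 / 2) : ℝ) ∧
      ∀ y c, ‖c‖ ≤ M → |driftKernel lam δ τ c (x - y)| ≤ Q y := by
  have i1 := (integrable_heatKernel_sub (t := τ + 2 * δ) (by positivity) x).const_mul lam
  have i2 := (integrable_heatKernelGrad_sub (t := τ + δ) (by positivity) x).norm.const_mul M
  refine ⟨_, i1.add i2, ?_, fun y c hc => ?_⟩
  · simp only [Pi.add_apply]
    rw [integral_add i1 i2, integral_const_mul, integral_const_mul,
      integral_heatKernel_sub (by positivity), mul_one, mul_assoc]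
    gcongr
    refine (integral_norm_heatKernelGrad_comp_sub_le (by positivity) x).trans ?_
    refine mul_le_mul_of_nonneg_left ?_ (heatConst_pos d).le
    exact Real.rpow_le_rpow_of_nonpos hτ (by linarith) (by norm_num)
  · have hK := heatKernel_nonneg (t := τ + 2 * δ) (by positivity) (x - y)
    have h1 := abs_real_inner_le_norm (heatKernelGrad (τ + δ) (x - y)) c
    have h2 : ‖heatKernelGrad (τ + δ) (x - y)‖ * ‖c‖ ≤
        M * ‖heatKernelGrad (τ + δ) (x - y)‖ := by rw [mul_comm]; gcongr
    have h3 : 0 ≤ lam * heatKernel (τ + 2 * δ) (x - y) := mul_nonneg hlam hK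
    simp only [Pi.add_apply, driftKernel]
    refine (abs_sub _ _).trans ?_
    rw [abs_of_nonneg h3]
    linarith

variable {b : ℝ → EuclideanSpace ℝ (Fin d) → EuclideanSpace ℝ (Fin d)}
  {w₀ : EuclideanSpace ℝ (Fin d) → ℝ} {W v : ℝ → EuclideanSpace ℝ (Fin d) → ℝ}

/-- Together with `approxData`, this is the Volterra form of
`∂ₜW = ΔW + B W - lam W`, in which the loss term `- lam W` has been absorbed into the semigroup
`e^{-lam t} K^t`. All kernels in it are nonnegative. -/
noncomputable def approxKernel (lam δ : ℝ)
    (b : ℝ → EuclideanSpace ℝ (Fin d) → EuclideanSpace ℝ (Fin d)) (t s : ℝ)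
    (x y : EuclideanSpace ℝ (Fin d)) (r : ℝ) : ℝ :=
  Real.exp (-(lam * (t - s))) * (driftKernel lam δ (t - s) (b s y) (x - y) * r)

/-- The free part of the Volterra form of the approximate equation. -/
noncomputable def approxData (lam : ℝ) (w₀ : EuclideanSpace ℝ (Fin d) → ℝ) (t : ℝ)
    (x : EuclideanSpace ℝ (Fin d)) : ℝ :=
  Real.exp (-(lam * t)) * heatFlow w₀ t x

lemma measurable_approxData (hw₀ : Measurable w₀) :
    Measurable (Function.uncurry (approxData lam w₀)) := by
  have := measurable_heatFlow hw₀
  exact (by fun_prop : Measurable fun p : ℝ × EuclideanSpace ℝ (Fin d) =>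
    Real.exp (-(lam * p.1))).mul this

lemma abs_approxData_le (hlam : 0 ≤ lam) {G : ℝ} (hG : ∀ x, |w₀ x| ≤ G) (t : ℝ)
    (x : EuclideanSpace ℝ (Fin d)) : |approxData lam w₀ t x| ≤ G := by
  rcases le_or_gt t 0 with ht | ht
  · rw [approxData, heatFlow_of_nonpos ht, mul_zero, abs_zero]
    exact (abs_nonneg _).trans (hG x)
  · have h1 : Real.exp (-(lam * t)) ≤ 1 := by
      rw [Real.exp_le_one_iff]
      have := mul_nonneg hlam ht.le
      linarith
    rw [approxData, abs_mul, abs_of_pos (Real.exp_pos _)]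
    exact (mul_le_of_le_one_left (abs_nonneg _) h1).trans (abs_heatFlow_le hG t x)

lemma mul_exp_neg_le_rpow {τ : ℝ} (hlam : 0 ≤ lam) (hτ : 0 < τ) :
    Real.exp (-(lam * τ)) * lam ≤ √lam * τ ^ (-(1 / 2) : ℝ) := by
  have hs : 0 < √τ := Real.sqrt_pos.2 hτ
  have e : τ ^ (-(1 / 2) : ℝ) = (√τ)⁻¹ := by
    rw [Real.rpow_neg hτ.le, Real.sqrt_eq_rpow]
  have h1 : √lam * √τ ≤ Real.exp (lam * τ) := by
    have h2 := Real.add_one_le_exp (lam * τ)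
    have h3 : (√lam * √τ) ^ 2 = lam * τ := by
      rw [mul_pow, Real.sq_sqrt hlam, Real.sq_sqrt hτ.le]
    nlinarith [sq_nonneg (√lam * √τ - 1)]
  rw [e, Real.exp_neg, ← div_eq_inv_mul, div_le_iff₀ (Real.exp_pos _)]
  calc lam = √lam * (√τ)⁻¹ * (√lam * √τ) := by
        field_simp
        rw [Real.sq_sqrt hlam]
    _ ≤ _ := by gcongr

lemma isLipschitzVolterra_approxKernel (hδ : 0 < δ) (hM : 0 ≤ M) (hlam : 0 ≤ lam)
    (hb : Measurable (Function.uncurry b)) (hbM : ∀ s y, ‖b s y‖ ≤ M) :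
    IsLipschitzVolterra (volume : Measure (EuclideanSpace ℝ (Fin d))) (approxKernel lam δ b)
      (√lam + M * heatConst d) 0 where
  nonneg_left := add_nonneg (Real.sqrt_nonneg _) (mul_nonneg hM (heatConst_pos d).le)
  nonneg_right := le_rfl
  measurable := by
    unfold approxKernel
    refine Measurable.mul (by fun_prop) (Measurable.mul ?_ (by fun_prop))
    exact (measurable_driftKernel lam δ).comp (f := fun p : (ℝ × ℝ) × (EuclideanSpace ℝ (Fin d) ×
      EuclideanSpace ℝ (Fin d)) × ℝ => (p.1.1 - p.1.2, b p.1.2 p.2.1.2, p.2.1.1 - p.2.1.2))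
      ((by fun_prop : Measurable fun p : (ℝ × ℝ) × (EuclideanSpace ℝ (Fin d) ×
        EuclideanSpace ℝ (Fin d)) × ℝ => p.1.1 - p.1.2).prodMk
        ((hb.comp (f := fun p : (ℝ × ℝ) × (EuclideanSpace ℝ (Fin d) ×
          EuclideanSpace ℝ (Fin d)) × ℝ => (p.1.2, p.2.1.2)) (by fun_prop)).prodMk
          (by fun_prop)))
  dominated t s x _ hst := by
    have hτ : 0 < t - s := sub_pos.2 hst
    obtain ⟨Q, hQi, hQA, hQ⟩ := driftKernel_bound hδ hM hlam hτ x
    have he : Real.exp (-(lam * (t - s))) ≤ 1 := by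
      rw [Real.exp_le_one_iff]
      have := mul_nonneg hlam hτ.le
      linarith
    refine ⟨fun y => Real.exp (-(lam * (t - s))) * Q y, hQi.const_mul _, ?_,
      fun y => ⟨?_, fun r r' => ?_⟩⟩
    · rw [integral_const_mul]
      have h1 := mul_le_mul_of_nonneg_left hQA (Real.exp_pos (-(lam * (t - s)))).le
      have h2 := mul_exp_neg_le_rpow hlam hτ
      have h3 : 0 ≤ M * heatConst d * (t - s) ^ (-(1 / 2) : ℝ) :=
        mul_nonneg (mul_nonneg hM (heatConst_pos d).le) (by positivity)
      have h4 := mul_le_of_le_one_left h3 he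
      linarith
    · simp [approxKernel]
    · rw [approxKernel, approxKernel, ← mul_sub, ← mul_sub, abs_mul, abs_mul,
        abs_of_pos (Real.exp_pos _), ← mul_assoc]
      exact mul_le_mul_of_nonneg_right
        (mul_le_mul_of_nonneg_left (hQ y _ (hbM s y)) (Real.exp_pos _).le) (abs_nonneg _)

lemma integral_Ioo_mul_exp (lam : ℝ) {s t : ℝ} (hst : s ≤ t) :
    ∫ r in Ioo s t, lam * Real.exp (-(lam * (r - s))) = 1 - Real.exp (-(lam * (t - s))) := by
  rw [← integral_Ioc_eq_integral_Ioo, ← intervalIntegral.integral_of_le hst,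
    intervalIntegral.integral_eq_sub_of_hasDerivAt
      (f := fun r => -Real.exp (-(lam * (r - s))))]
  · simp; ring
  · intro r _
    have h : HasDerivAt (fun r : ℝ => -(lam * (r - s))) (-lam) r := by
      simpa using (((hasDerivAt_id r).sub_const s).const_mul lam).fun_neg
    refine h.exp.fun_neg.congr_deriv ?_
    ring
  · exact (by fun_prop : Continuous fun r : ℝ =>
      lam * Real.exp (-(lam * (r - s)))).intervalIntegrable _ _

lemma integral_Ioo_mul_exp_sub (lam : ℝ) {t : ℝ} (ht : 0 ≤ t) :
    ∫ s in Ioo 0 t, lam * Real.exp (-(lam * (t - s))) = 1 - Real.exp (-(lam * t)) := by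
  rw [setIntegral_sub_comp (fun s => lam * Real.exp (-(lam * s))) ht]
  simpa using integral_Ioo_mul_exp lam ht

lemma lintegral_enorm_of_nonneg {X : Type*} [MeasurableSpace X] {μ : Measure X} {f : X → ℝ}
    (hf : Integrable f μ) (h0 : ∀ x, 0 ≤ f x) :
    ∫⁻ x, ‖f x‖ₑ ∂μ = ENNReal.ofReal (∫ x, f x ∂μ) := by
  rw [ofReal_integral_eq_lintegral_ofReal hf (Eventually.of_forall h0)]
  exact lintegral_congr fun x => Real.enorm_of_nonneg (h0 x)

lemma lintegral_heatFlow_le {t : ℝ} (ht : 0 < t) (hw₀ : Measurable w₀) :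
    ∫⁻ x, ‖heatFlow w₀ t x‖ₑ ≤ ∫⁻ y, ‖w₀ y‖ₑ := by
  calc ∫⁻ x, ‖heatFlow w₀ t x‖ₑ ≤ ∫⁻ x, ∫⁻ y, ‖heatKernel t (x - y) * w₀ y‖ₑ := by
        refine lintegral_mono fun x => ?_
        rw [heatFlow_of_pos ht]
        exact enorm_integral_le_lintegral_enorm _
    _ = ∫⁻ y, ∫⁻ x, ‖heatKernel t (x - y) * w₀ y‖ₑ := by
        refine lintegral_lintegral_swap (Measurable.aemeasurable ?_)
        exact ((measurable_heatKernel.comp (f := fun p : EuclideanSpace ℝ (Fin d) ×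
          EuclideanSpace ℝ (Fin d) => (t, p.1 - p.2)) (by fun_prop)).mul
          (hw₀.comp measurable_snd)).enorm
    _ = ∫⁻ y, ‖w₀ y‖ₑ := by
        refine lintegral_congr fun y => ?_
        simp_rw [enorm_mul]
        rw [lintegral_mul_const' _ _ enorm_ne_top,
          lintegral_enorm_of_nonneg ((integrable_heatKernel ht).comp_sub_right y)
            (fun x => heatKernel_nonneg ht.le _),
          integral_sub_right_eq_self (fun x => heatKernel t x), integral_heatKernel ht]
        simp

lemma measurable_approxKernel_comp (hδ : 0 < δ) (hM : 0 ≤ M) (hlam : 0 ≤ lam)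
    (hb : Measurable (Function.uncurry b)) (hbM : ∀ s y, ‖b s y‖ ≤ M)
    (hv : Measurable (Function.uncurry v)) (t : ℝ) :
    Measurable fun p : EuclideanSpace ℝ (Fin d) × (ℝ × EuclideanSpace ℝ (Fin d)) =>
      approxKernel lam δ b t p.2.1 p.1 p.2.2 (v p.2.1 p.2.2) :=
  (isLipschitzVolterra_approxKernel hδ hM hlam hb hbM).measurable.comp
    (f := fun p : EuclideanSpace ℝ (Fin d) × (ℝ × EuclideanSpace ℝ (Fin d)) =>
      ((t, p.2.1), (p.1, p.2.2), v p.2.1 p.2.2))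
    ((by fun_prop : Measurable fun p : EuclideanSpace ℝ (Fin d) ×
      (ℝ × EuclideanSpace ℝ (Fin d)) => (t, p.2.1)).prodMk
      ((by fun_prop : Measurable fun p : EuclideanSpace ℝ (Fin d) ×
        (ℝ × EuclideanSpace ℝ (Fin d)) => (p.1, p.2.2)).prodMk (hv.comp measurable_snd)))

/-- The approximate Volterra operator does not increase the `L¹` norm: its kernels are nonnegative
and their masses add up to `e^{-lam t} + ∫₀ᵗ lam e^{-lam (t - s)} ds = 1`. -/
lemma lintegral_approx_volterra_le (hδ : 0 < δ) (hM : 0 ≤ M) (hlam0 : 0 ≤ lam)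
    (hlam : M * heatConst d * δ ^ (-(1 / 2) : ℝ) ≤ lam)
    (hb : Measurable (Function.uncurry b)) (hbM : ∀ s y, ‖b s y‖ ≤ M) (hw₀ : Measurable w₀)
    (hv : Measurable (Function.uncurry v)) (hvI : ∀ s, ∫⁻ y, ‖v s y‖ₑ ≤ ∫⁻ y, ‖w₀ y‖ₑ) (t : ℝ) :
    ∫⁻ x, ‖volterra volume (approxData lam w₀) (approxKernel lam δ b) v t x‖ₑ ≤
      ∫⁻ y, ‖w₀ y‖ₑ := by
  rcases le_or_gt t 0 with ht | ht
  · simp [volterra, approxData, heatFlow_of_nonpos ht, Ioo_eq_empty_of_le ht]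
  set I := ∫⁻ y, ‖w₀ y‖ₑ
  have hdata : ∫⁻ x, ‖approxData lam w₀ t x‖ₑ ≤ ENNReal.ofReal (Real.exp (-(lam * t))) * I := by
    unfold approxData
    simp_rw [enorm_mul]
    rw [lintegral_const_mul' _ _ enorm_ne_top, Real.enorm_of_nonneg (Real.exp_pos _).le]
    gcongr
    exact lintegral_heatFlow_le ht hw₀
  have hmeas := measurable_approxKernel_comp hδ hM hlam0 hb hbM hv t
  have hker : ∫⁻ x, ∫⁻ s in Ioo 0 t, ∫⁻ y, ‖approxKernel lam δ b t s x y (v s y)‖ₑ ≤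
      ENNReal.ofReal (1 - Real.exp (-(lam * t))) * I := by
    rw [lintegral_triple_swap (τ := volume.restrict (Ioo 0 t)) hmeas.enorm]
    calc _ ≤ ∫⁻ s in Ioo 0 t, ENNReal.ofReal (lam * Real.exp (-(lam * (t - s)))) * I := by
          refine setLIntegral_mono' measurableSet_Ioo fun s hs => ?_
          have hτ : 0 ≤ t - s := by linarith [hs.2]
          have e : ∀ y, ∫⁻ x, ‖approxKernel lam δ b t s x y (v s y)‖ₑ =
              ENNReal.ofReal (lam * Real.exp (-(lam * (t - s)))) * ‖v s y‖ₑ := by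
            intro y
            unfold approxKernel
            simp_rw [enorm_mul]
            rw [lintegral_const_mul' _ _ enorm_ne_top, lintegral_mul_const' _ _ enorm_ne_top,
              lintegral_enorm_of_nonneg ((integrable_driftKernel lam hδ hτ _).comp_sub_right y)
                (fun x => driftKernel_nonneg hδ hlam hτ (hbM s y) _),
              integral_sub_right_eq_self (fun x => driftKernel lam δ (t - s) (b s y) x),
              integral_driftKernel lam hδ hτ, Real.enorm_of_nonneg (Real.exp_pos _).le,
              ← mul_assoc, ← ENNReal.ofReal_mul (Real.exp_pos _).le, mul_comm (Real.exp _)]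
          simp_rw [e]
          rw [lintegral_const_mul' _ _ ENNReal.ofReal_ne_top]
          gcongr
          exact hvI s
      _ = ENNReal.ofReal (1 - Real.exp (-(lam * t))) * I := by
          rw [lintegral_mul_const _ (by fun_prop), ← integral_Ioo_mul_exp_sub lam ht.le,
            ofReal_integral_eq_lintegral_ofReal]
          · exact (by fun_prop : Continuous fun s : ℝ => lam * Real.exp
              (-(lam * (t - s)))).integrableOn_Icc.mono_set Ioo_subset_Icc_self
          · exact Eventually.of_forall fun s => mul_nonneg hlam0 (Real.exp_pos _).le
  calc _ ≤ ∫⁻ x, (‖approxData lam w₀ t x‖ₑ +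
        ∫⁻ s in Ioo 0 t, ∫⁻ y, ‖approxKernel lam δ b t s x y (v s y)‖ₑ) := by
        refine lintegral_mono fun x => (enorm_add_le _ _).trans ?_
        gcongr
        refine (enorm_integral_le_lintegral_enorm _).trans ?_
        exact lintegral_mono fun s => enorm_integral_le_lintegral_enorm _
    _ ≤ ENNReal.ofReal (Real.exp (-(lam * t))) * I +
        ENNReal.ofReal (1 - Real.exp (-(lam * t))) * I := by
        rw [lintegral_add_left]
        · exact add_le_add hdata hker
        · exact ((measurable_approxData hw₀).comp measurable_prodMk_left).enorm
    _ = I := by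
        have : Real.exp (-(lam * t)) ≤ 1 := by
          rw [Real.exp_le_one_iff]
          have := mul_nonneg hlam0 ht.le
          linarith
        rw [← add_mul, ← ENNReal.ofReal_add (Real.exp_pos _).le (by linarith)]
        simp

/-- The approximate equation is solvable, and its solution satisfies the `L¹` bound. -/
lemma exists_approx_solution (hδ : 0 < δ) (hM : 0 ≤ M) (hlam0 : 0 ≤ lam)
    (hlam : M * heatConst d * δ ^ (-(1 / 2) : ℝ) ≤ lam)
    (hb : Measurable (Function.uncurry b)) (hbM : ∀ s y, ‖b s y‖ ≤ M) (hw₀ : Measurable w₀) {G : ℝ}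
    (hG : ∀ x, |w₀ x| ≤ G) :
    ∃ W : ℝ → EuclideanSpace ℝ (Fin d) → ℝ, Measurable (Function.uncurry W) ∧
      (∀ T, ∃ C, ∀ t ∈ Ioc 0 T, ∀ x, |W t x| ≤ C) ∧
      (∀ t > 0, ∀ x, W t x =
        volterra volume (approxData lam w₀) (approxKernel lam δ b) W t x) ∧
      ∀ t, ∫⁻ x, ‖W t x‖ₑ ≤ ∫⁻ x, ‖w₀ x‖ₑ := by
  obtain ⟨hm, W, hWm, hlim, hWb, hW⟩ :=
    (isLipschitzVolterra_approxKernel hδ hM hlam0 hb hbM).exists_fixed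
      (measurable_approxData (lam := lam) hw₀) (abs_approxData_le hlam0 hG)
  refine ⟨W, hWm, hWb, hW, fun t => ?_⟩
  have hn : ∀ n t, ∫⁻ x, ‖picard volume (approxData lam w₀) (approxKernel lam δ b) n t x‖ₑ ≤
      ∫⁻ x, ‖w₀ x‖ₑ := by
    intro n
    induction n with
    | zero => intro t; simp [picard]
    | succ n ih =>
      exact lintegral_approx_volterra_le hδ hM hlam0 hlam hb hbM hw₀ (hm n) ih
  calc ∫⁻ x, ‖W t x‖ₑ = ∫⁻ x, liminf (fun n =>
        ‖picard volume (approxData lam w₀) (approxKernel lam δ b) n t x‖ₑ) atTop :=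
        lintegral_congr fun x => ((hlim t x).enorm.liminf_eq).symm
    _ ≤ liminf (fun n => ∫⁻ x,
        ‖picard volume (approxData lam w₀) (approxKernel lam δ b) n t x‖ₑ) atTop :=
        lintegral_liminf_le fun n => ((hm n).comp measurable_prodMk_left).enorm
    _ ≤ _ := liminf_le_of_le (by isBoundedDefault) fun c hc => by
        obtain ⟨n, hn'⟩ := hc.exists
        exact hn'.trans (hn n t)

end Drift

/-! ### The approximate equation in Duhamel form -/

section Duhamel

lemma integrableOn_exp_mul {a : ℝ → ℝ} {t lam : ℝ} (ha : IntegrableOn a (Ioo 0 t)) (r : ℝ) :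
    IntegrableOn (fun s => Real.exp (-(lam * (r - s))) * a s) (Ioo 0 t) := by
  have hc : Continuous fun s : ℝ => Real.exp (-(lam * (r - s))) := by fun_prop
  obtain ⟨C, hC⟩ := (isCompact_Icc (a := (0 : ℝ)) (b := t)).exists_bound_of_continuousOn
    hc.continuousOn
  refine Integrable.bdd_mul (c := C) ha hc.aestronglyMeasurable ?_
  filter_upwards [ae_restrict_mem measurableSet_Ioo] with s hs
  exact hC s (Ioo_subset_Icc_self hs)

/-- Variation of constants for the scalar equation `H' = a - lam H`, in integrated form. -/
lemma integral_variation_of_constants {a H : ℝ → ℝ} {t lam h₀ : ℝ} (ht : 0 < t) (hlam : 0 ≤ lam)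
    (ha : IntegrableOn a (Ioo 0 t))
    (hH : ∀ r ∈ Ioo 0 t, H r = Real.exp (-(lam * r)) * h₀ +
      ∫ s in Ioo 0 r, Real.exp (-(lam * (r - s))) * a s) :
    Real.exp (-(lam * t)) * h₀ + ∫ s in Ioo 0 t, Real.exp (-(lam * (t - s))) * a s =
      h₀ + (∫ s in Ioo 0 t, a s) - ∫ s in Ioo 0 t, lam * H s := by
  set ρ := (volume.restrict (Ioo (0 : ℝ) t)) with hρ
  set F : ℝ → ℝ → ℝ := fun r s =>
    (if s < r then lam * Real.exp (-(lam * (r - s))) else 0) * a s with hF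
  have hind : Measurable fun p : ℝ × ℝ =>
      if p.2 < p.1 then lam * Real.exp (-(lam * (p.1 - p.2))) else 0 :=
    Measurable.ite (measurableSet_lt measurable_snd measurable_fst) (by fun_prop) measurable_const
  have hFint : Integrable (Function.uncurry F) (ρ.prod ρ) := by
    have h1 : Integrable (fun p : ℝ × ℝ => (1 : ℝ) * a p.2) (ρ.prod ρ) :=
      Integrable.mul_prod (integrable_const (1 : ℝ)) ha
    simp only [one_mul] at h1
    refine Integrable.bdd_mul (c := lam) h1 hind.aestronglyMeasurable (Eventually.of_forall ?_)
    rintro ⟨r, s⟩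
    dsimp only
    split_ifs with h
    · rw [Real.norm_of_nonneg (mul_nonneg hlam (Real.exp_pos _).le)]
      refine mul_le_of_le_one_right hlam ?_
      rw [Real.exp_le_one_iff]
      have := mul_nonneg hlam (sub_nonneg.2 h.le)
      linarith
    · simpa using hlam
  have hswap := integral_integral_swap hFint
  have hleft : ∀ r ∈ Ioo 0 t, ∫ s, F r s ∂ρ =
      lam * ∫ s in Ioo 0 r, Real.exp (-(lam * (r - s))) * a s := by
    intro r hr
    have e : ∀ s, F r s =
        (Iio r).indicator (fun s => lam * (Real.exp (-(lam * (r - s))) * a s)) s := by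
      intro s
      simp only [hF, indicator, mem_Iio]
      split_ifs <;> ring
    simp_rw [e]
    rw [integral_indicator measurableSet_Iio, hρ, Measure.restrict_restrict measurableSet_Iio,
      integral_const_mul, Iio_inter_Ioo, min_eq_left hr.2.le]
  have hright : ∀ s ∈ Ioo 0 t, ∫ r, F r s ∂ρ =
      a s - Real.exp (-(lam * (t - s))) * a s := by
    intro s hs
    have e : ∀ r, F r s =
        (Ioi s).indicator (fun r => lam * Real.exp (-(lam * (r - s)))) r * a s := by
      intro r
      simp only [hF, indicator, mem_Ioi]
    simp_rw [e]
    rw [integral_mul_const, integral_indicator measurableSet_Ioi, hρ,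
      Measure.restrict_restrict measurableSet_Ioi, Ioi_inter_Ioo, max_eq_left hs.1.le,
      integral_Ioo_mul_exp lam hs.2.le]
    ring
  have e1 : ∫ r in Ioo 0 t, lam * H r =
      ∫ r in Ioo 0 t, (lam * Real.exp (-(lam * (r - 0))) * h₀ + ∫ s, F r s ∂ρ) := by
    refine setIntegral_congr_fun measurableSet_Ioo fun r hr => ?_
    simp only [hH r hr, hleft r hr, sub_zero]
    ring
  have i1 : Integrable (fun r : ℝ => lam * Real.exp (-(lam * (r - 0))) * h₀) ρ :=
    (by fun_prop : Continuous fun r : ℝ =>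
      lam * Real.exp (-(lam * (r - 0))) * h₀).integrableOn_Icc.mono_set Ioo_subset_Icc_self
  have e2 : ∫ s, ∫ r, F r s ∂ρ ∂ρ =
      (∫ s in Ioo 0 t, a s) - ∫ s in Ioo 0 t, Real.exp (-(lam * (t - s))) * a s := by
    rw [← integral_sub ha (integrableOn_exp_mul ha t)]
    exact setIntegral_congr_fun measurableSet_Ioo hright
  have i2 : Integrable (fun r => ∫ s, F r s ∂ρ) ρ := hFint.integral_prod_left
  rw [e1, integral_add i1 i2, integral_mul_const, integral_Ioo_mul_exp lam ht.le, sub_zero, hswap,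
    e2]
  ring

variable {d : ℕ} {lam δ M : ℝ}
  {b : ℝ → EuclideanSpace ℝ (Fin d) → EuclideanSpace ℝ (Fin d)}
  {w₀ : EuclideanSpace ℝ (Fin d) → ℝ} {W : ℝ → EuclideanSpace ℝ (Fin d) → ℝ}

lemma integral_heatKernel_conv_heatFlow (hw₀ : Measurable w₀) {G : ℝ} (hG : ∀ x, |w₀ x| ≤ G)
    {s t : ℝ} (hs : 0 < s) (ht : 0 < t) (x : EuclideanSpace ℝ (Fin d)) :
    ∫ z, heatKernel s (x - z) * heatFlow w₀ t z = heatFlow w₀ (s + t) x := by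
  have hm : Measurable fun p : EuclideanSpace ℝ (Fin d) × EuclideanSpace ℝ (Fin d) =>
      heatKernel s (x - p.1) * (heatKernel t (p.1 - p.2) * w₀ p.2) := by
    refine ((measurable_heatKernel_sub s x).comp measurable_fst).mul (Measurable.mul ?_
      (hw₀.comp measurable_snd))
    exact measurable_heatKernel.comp (f := fun p : EuclideanSpace ℝ (Fin d) ×
      EuclideanSpace ℝ (Fin d) => (t, p.1 - p.2)) (by fun_prop)
  have hfin : ∫⁻ z, ∫⁻ y, ‖heatKernel s (x - z) * (heatKernel t (z - y) * w₀ y)‖ₑ ≠ ⊤ := by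
    refine ne_top_of_le_ne_top (b := 1 * ENNReal.ofReal G) (by simp) ?_
    calc _ ≤ ∫⁻ z, ‖heatKernel s (x - z)‖ₑ * ENNReal.ofReal G := by
          refine lintegral_mono fun z => ?_
          simp_rw [enorm_mul (heatKernel s (x - z))]
          rw [lintegral_const_mul' _ _ enorm_ne_top]
          gcongr
          calc _ ≤ ∫⁻ y, ‖heatKernel t (z - y)‖ₑ * ENNReal.ofReal G := by
                refine lintegral_mono fun y => ?_
                rw [enorm_mul]
                gcongr
                rw [Real.enorm_eq_ofReal_abs]
                exact ENNReal.ofReal_le_ofReal (hG y)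
            _ = _ := by
                rw [lintegral_mul_const' _ _ ENNReal.ofReal_ne_top,
                  lintegral_enorm_of_nonneg (integrable_heatKernel_sub ht z)
                    (fun y => heatKernel_nonneg ht.le _), integral_heatKernel_sub ht]
                simp
      _ = _ := by
          rw [lintegral_mul_const' _ _ ENNReal.ofReal_ne_top,
            lintegral_enorm_of_nonneg (integrable_heatKernel_sub hs x)
              (fun y => heatKernel_nonneg hs.le _), integral_heatKernel_sub hs]
          simp
  have hI := integrable_prod_of_lintegral_ne_top (μ := volume) (ν := volume) hm hfin
  simp_rw [heatFlow_of_pos ht, heatFlow_of_pos (add_pos hs ht), ← integral_const_mul]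
  rw [integral_integral_swap (f := fun z y => heatKernel s (x - z) *
    (heatKernel t (z - y) * w₀ y)) hI]
  refine integral_congr_ae (Eventually.of_forall fun y => ?_)
  simp only [← mul_assoc]
  rw [integral_mul_const, integral_heatKernel_conv hs ht]

/-- Applying `K^{t - r}` to a solution of the approximate equation at time `r`: by the semigroup
property, the resulting integrand depends on `r` only through the exponential factor. -/
lemma integral_heatKernel_conv_approx (hδ : 0 < δ) (hM : 0 ≤ M) (hlam0 : 0 ≤ lam)
    (hb : Measurable (Function.uncurry b)) (hbM : ∀ s y, ‖b s y‖ ≤ M) (hw₀ : Measurable w₀)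
    {G : ℝ} (hG : ∀ x, |w₀ x| ≤ G) (hW : Measurable (Function.uncurry W)) {t C : ℝ}
    (hWC : ∀ s ∈ Ioc 0 t, ∀ x, |W s x| ≤ C)
    (hWeq : ∀ s > 0, ∀ x, W s x =
        volterra volume (approxData lam w₀) (approxKernel lam δ b) W s x)
    (x : EuclideanSpace ℝ (Fin d)) {r : ℝ} (hr : r ∈ Ioo 0 t) :
    ∫ z, heatKernel (t - r) (x - z) * W r z = Real.exp (-(lam * r)) * heatFlow w₀ t x +
      ∫ s in Ioo 0 r, Real.exp (-(lam * (r - s))) *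
        ∫ y, driftKernel lam δ (t - s) (b s y) (x - y) * W s y := by
  have htr : 0 < t - r := sub_pos.2 hr.2
  have hN := isLipschitzVolterra_approxKernel hδ hM hlam0 hb hbM
  have hWr : ∀ s ∈ Ioo 0 r, ∀ y, |W s y| ≤ C := fun s hs => hWC s ⟨hs.1, (hs.2.trans hr.2).le⟩
  have hm : Measurable fun p : EuclideanSpace ℝ (Fin d) × (ℝ × EuclideanSpace ℝ (Fin d)) =>
      heatKernel (t - r) (x - p.1) * approxKernel lam δ b r p.2.1 p.1 p.2.2 (W p.2.1 p.2.2) :=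
    ((measurable_heatKernel_sub (t - r) x).comp measurable_fst).mul
      (measurable_approxKernel_comp hδ hM hlam0 hb hbM hW r)
  have hα : Integrable (fun s => (√lam + M * heatConst d) * (0 + C) * (r - s) ^ (-(1 / 2) : ℝ))
      (volume.restrict (Ioo 0 r)) := (integrableOn_rpow_Ioo (by norm_num) r).const_mul _
  have hfin : ∫⁻ z, ∫⁻ s in Ioo 0 r, ∫⁻ y,
      ‖heatKernel (t - r) (x - z) * approxKernel lam δ b r s z y (W s y)‖ₑ ≠ ⊤ := by
    set A := ∫⁻ s in Ioo 0 r,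
      ENNReal.ofReal ((√lam + M * heatConst d) * (0 + C) * (r - s) ^ (-(1 / 2) : ℝ)) with hA
    have hAfin : A ≠ ⊤ := hα.lintegral_lt_top.ne
    refine ne_top_of_le_ne_top (b := 1 * A) (by simpa using hAfin) ?_
    calc _ ≤ ∫⁻ z, ‖heatKernel (t - r) (x - z)‖ₑ * A := by
          refine lintegral_mono fun z => ?_
          simp_rw [enorm_mul (heatKernel (t - r) (x - z))]
          simp_rw [lintegral_const_mul' _ _ enorm_ne_top]
          gcongr
          refine setLIntegral_mono' measurableSet_Ioo fun s hs => ?_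
          obtain ⟨Q, hQi, hQA, hQ⟩ := hN.dominated_of_bounded hs (hWr s hs) z
          calc _ ≤ ∫⁻ y, ‖Q y‖ₑ := by
                refine lintegral_mono fun y => ?_
                rw [Real.enorm_eq_ofReal_abs, Real.enorm_eq_ofReal_abs]
                exact ENNReal.ofReal_le_ofReal ((hQ y).trans (le_abs_self _))
            _ = ENNReal.ofReal (∫ y, Q y) :=
                lintegral_enorm_of_nonneg hQi fun y => (abs_nonneg _).trans (hQ y)
            _ ≤ _ := ENNReal.ofReal_le_ofReal hQA
      _ = _ := by
          rw [lintegral_mul_const' _ _ hAfin,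
            lintegral_enorm_of_nonneg (integrable_heatKernel_sub htr x)
              (fun y => heatKernel_nonneg htr.le _), integral_heatKernel_sub htr]
          simp
  obtain ⟨hI, hswap⟩ := integral_triple_swap (μ := volume) (ν := volume)
    (τ := volume.restrict (Ioo 0 r)) hm hfin
  have hI2 : Integrable fun z => heatKernel (t - r) (x - z) * approxData lam w₀ r z :=
    Integrable.mul_bdd (c := G) (integrable_heatKernel_sub htr x)
      ((measurable_approxData hw₀).comp measurable_prodMk_left).aestronglyMeasurable
      (Eventually.of_forall fun z => abs_approxData_le hlam0 hG r z)
  have e : ∀ z, heatKernel (t - r) (x - z) * W r z =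
      heatKernel (t - r) (x - z) * approxData lam w₀ r z + ∫ s in Ioo 0 r, ∫ y,
        heatKernel (t - r) (x - z) * approxKernel lam δ b r s z y (W s y) := by
    intro z
    rw [hWeq r hr.1 z, volterra, mul_add]
    simp_rw [integral_const_mul]
  simp_rw [e]
  rw [integral_add hI2 hI, hswap]
  congr 1
  · unfold approxData
    simp_rw [mul_left_comm _ (Real.exp _)]
    rw [integral_const_mul, integral_heatKernel_conv_heatFlow hw₀ hG htr hr.1, sub_add_cancel]
  · refine setIntegral_congr_fun measurableSet_Ioo fun s hs => ?_
    dsimp only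
    rw [← integral_const_mul]
    refine integral_congr_ae (Eventually.of_forall fun y => ?_)
    dsimp only
    unfold approxKernel
    have e3 : ∀ z, heatKernel (t - r) (x - z) * (Real.exp (-(lam * (r - s))) *
        (driftKernel lam δ (r - s) (b s y) (z - y) * W s y)) =
        (heatKernel (t - r) (x - z) * driftKernel lam δ (r - s) (b s y) (z - y)) *
          (Real.exp (-(lam * (r - s))) * W s y) := fun z => by ring
    simp_rw [e3]
    rw [integral_mul_const, integral_heatKernel_conv_driftKernel lam hδ htr (by linarith [hs.2]),
      show t - r + (r - s) = t - s by ring]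
    ring

/-- The approximate equation in Duhamel form, with the loss term `- lam W` made explicit. -/
lemma approx_duhamel (hδ : 0 < δ) (hM : 0 ≤ M) (hlam0 : 0 ≤ lam)
    (hb : Measurable (Function.uncurry b)) (hbM : ∀ s y, ‖b s y‖ ≤ M) (hw₀ : Measurable w₀)
    {G : ℝ} (hG : ∀ x, |w₀ x| ≤ G) (hW : Measurable (Function.uncurry W)) {t C : ℝ}
    (hWC : ∀ s ∈ Ioc 0 t, ∀ x, |W s x| ≤ C)
    (hWeq : ∀ s > 0, ∀ x, W s x =
        volterra volume (approxData lam w₀) (approxKernel lam δ b) W s x) (ht : 0 < t)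
    (x : EuclideanSpace ℝ (Fin d)) :
    W t x = heatFlow w₀ t x + ∫ s in Ioo 0 t, ∫ y,
      (driftKernel lam δ (t - s) (b s y) (x - y) - lam * heatKernel (t - s) (x - y)) * W s y := by
  set a : ℝ → ℝ := fun s => ∫ y, driftKernel lam δ (t - s) (b s y) (x - y) * W s y with ha_def
  set H : ℝ → ℝ := fun s => ∫ y, heatKernel (t - s) (x - y) * W s y with hH_def
  have hma : Measurable (Function.uncurry fun s y =>
      driftKernel lam δ (t - s) (b s y) (x - y) * W s y) := by
    refine Measurable.mul ?_ hW
    exact (measurable_driftKernel lam δ).comp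
      (f := fun p : ℝ × EuclideanSpace ℝ (Fin d) => (t - p.1, b p.1 p.2, x - p.2))
      ((by fun_prop : Measurable fun p : ℝ × EuclideanSpace ℝ (Fin d) => t - p.1).prodMk
        (hb.prodMk (by fun_prop)))
  have hmH : Measurable (Function.uncurry fun s y => heatKernel (t - s) (x - y) * W s y) := by
    refine Measurable.mul ?_ hW
    exact measurable_heatKernel.comp
      (f := fun p : ℝ × EuclideanSpace ℝ (Fin d) => (t - p.1, x - p.2)) (by fun_prop)
  have hWt : ∀ s ∈ Ioo 0 t, ∀ y, |W s y| ≤ C := fun s hs => hWC s (Ioo_subset_Ioc_self hs)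
  have hC : 0 ≤ C := (abs_nonneg _).trans (hWC t ⟨ht, le_rfl⟩ x)
  obtain ⟨ha1, ha2, -⟩ := iterated_integral_bound (t := t)
    (a := fun s => (lam + M * heatConst d * (t - s) ^ (-(1 / 2) : ℝ)) * C) hma (fun s hs => by
      obtain ⟨Q, hQi, hQA, hQ⟩ := driftKernel_bound hδ hM hlam0 (sub_pos.2 hs.2) x
      refine ⟨fun y => Q y * C, hQi.mul_const C, ?_, fun y => ?_⟩
      · rw [integral_mul_const]
        gcongr
      · rw [abs_mul]
        exact mul_le_mul (hQ y _ (hbM s y)) (hWt s hs y) (abs_nonneg _)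
          ((abs_nonneg _).trans (hQ y _ (hbM s y))))
    (((integrable_const lam).add
      ((integrableOn_rpow_Ioo (by norm_num) t).const_mul (M * heatConst d))).mul_const C)
  obtain ⟨hH1, hH2, -⟩ := iterated_integral_bound (t := t) (a := fun _ => C) hmH (fun s hs => by
      refine ⟨fun y => heatKernel (t - s) (x - y) * C,
        (integrable_heatKernel_sub (sub_pos.2 hs.2) x).mul_const C, ?_, fun y => ?_⟩
      · rw [integral_mul_const, integral_heatKernel_sub (sub_pos.2 hs.2), one_mul]
      · have h0 := heatKernel_nonneg (sub_pos.2 hs.2).le (x - y)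
        rw [abs_mul, abs_of_nonneg h0]
        exact mul_le_mul_of_nonneg_left (hWt s hs y) h0) (integrable_const C)
  have e1 : W t x = Real.exp (-(lam * t)) * heatFlow w₀ t x +
      ∫ s in Ioo 0 t, Real.exp (-(lam * (t - s))) * a s := by
    rw [hWeq t ht x, volterra, approxData]
    congr 1
    refine setIntegral_congr_fun measurableSet_Ioo fun s _ => ?_
    exact integral_const_mul _ _
  rw [e1, integral_variation_of_constants (H := H) ht hlam0 ha2 (fun r hr =>
    integral_heatKernel_conv_approx hδ hM hlam0 hb hbM hw₀ hG hW hWC hWeq x hr),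
    add_sub_assoc, ← integral_sub ha2 (hH2.const_mul lam)]
  congr 1
  refine setIntegral_congr_fun measurableSet_Ioo fun s hs => ?_
  rw [← integral_const_mul, ← integral_sub (ha1 s hs) ((hH1 s hs).const_mul lam)]
  refine integral_congr_ae (Eventually.of_forall fun y => ?_)
  ring

end Duhamel

/-! ### Convergence of the approximations and the `L¹` bound -/

section Comparison

variable {d : ℕ} {M δ : ℝ} {b : ℝ → EuclideanSpace ℝ (Fin d) → EuclideanSpace ℝ (Fin d)}
  {w₀ : EuclideanSpace ℝ (Fin d) → ℝ} {W w : ℝ → EuclideanSpace ℝ (Fin d) → ℝ}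

/-- The least loss rate for which `driftKernel_nonneg` applies to drifts bounded by `M`. -/
noncomputable def lossRate (d : ℕ) (M δ : ℝ) : ℝ := M * heatConst d * δ ^ (-(1 / 2) : ℝ)

/-- The constant in the consistency estimate `exists_consistency_bound`. -/
noncomputable def consistencyConst (d : ℕ) (M : ℝ) : ℝ := 12 * d * heatConst d * M

lemma consistencyConst_nonneg (hM : 0 ≤ M) : 0 ≤ consistencyConst d M :=
  mul_nonneg (mul_nonneg (by positivity) (heatConst_pos d).le) hM

/-- Smoothing by `K^τ` makes the approximate operator `B - lam` close to `-div (c ⬝)`. The loss rate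
is of order `δ^{-1/2}`, but it multiplies `K^{τ + 2δ} - K^τ`, whose `L¹` norm is of order
`(δ / τ)^{3/4}`. -/
lemma exists_consistency_bound (hδ : 0 < δ) (hM : 0 ≤ M) {τ : ℝ} (hτ : 0 < τ)
    (x : EuclideanSpace ℝ (Fin d)) : ∃ Q : EuclideanSpace ℝ (Fin d) → ℝ, Integrable Q ∧
      ∫ y, Q y ≤ consistencyConst d M * δ ^ (1 / 4 : ℝ) * τ ^ (-(3 / 4) : ℝ) ∧
      ∀ y c, ‖c‖ ≤ M → |driftKernel (lossRate d M δ) δ τ c (x - y) -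
        lossRate d M δ * heatKernel τ (x - y) +
          inner ℝ (heatKernelGrad τ (x - y)) c| ≤ Q y := by
  have hc := heatConst_pos d
  have hlam : 0 ≤ lossRate d M δ := by unfold lossRate; positivity
  set P : EuclideanSpace ℝ (Fin d) → ℝ := fun z => lossRate d M δ *
    |heatKernel (τ + 2 * δ) z - heatKernel τ z| +
      M * ‖heatKernelGrad (τ + δ) z - heatKernelGrad τ z‖ with hP
  have i1 : Integrable fun z : EuclideanSpace ℝ (Fin d) => lossRate d M δ *
      |heatKernel (τ + 2 * δ) z - heatKernel τ z| :=
    ((integrable_heatKernel (by positivity)).sub (integrable_heatKernel hτ)).abs.const_mul _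
  have i2 : Integrable fun z : EuclideanSpace ℝ (Fin d) =>
      M * ‖heatKernelGrad (τ + δ) z - heatKernelGrad τ z‖ :=
    ((integrable_heatKernelGrad (by positivity)).sub
      (integrable_heatKernelGrad hτ)).norm.const_mul _
  have hPi : Integrable P := i1.add i2
  refine ⟨fun y => P (x - y), hPi.comp_sub_left x, ?_, fun y c hcM => ?_⟩
  · rw [integral_sub_left_eq_self P, hP, integral_add i1 i2, integral_const_mul,
      integral_const_mul]
    have h1 := integral_abs_heatKernel_sub_le (d := d) hτ (h := 2 * δ) (by positivity)
      (p := 3 / 4) (by norm_num) (by norm_num)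
    have h2 := integral_norm_heatKernelGrad_sub_le (d := d) hτ hδ.le
    have e1 : (2 * δ / τ) ^ (3 / 4 : ℝ) ≤ 2 * (δ ^ (3 / 4 : ℝ) * τ ^ (-(3 / 4) : ℝ)) := by
      rw [Real.div_rpow (by positivity) hτ.le, Real.mul_rpow (by norm_num) hδ.le,
        Real.rpow_neg hτ.le, div_eq_mul_inv, mul_assoc]
      gcongr
      calc (2 : ℝ) ^ (3 / 4 : ℝ) ≤ 2 ^ (1 : ℝ) :=
            Real.rpow_le_rpow_of_exponent_le (by norm_num) (by norm_num)
        _ = 2 := Real.rpow_one _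
    have e2 : δ ^ (-(1 / 2) : ℝ) * δ ^ (3 / 4 : ℝ) = δ ^ (1 / 4 : ℝ) := by
      rw [← Real.rpow_add hδ]; norm_num
    have h3 : lossRate d M δ *
        ∫ z : EuclideanSpace ℝ (Fin d), |heatKernel (τ + 2 * δ) z - heatKernel τ z| ≤
        4 * d * heatConst d * M * δ ^ (1 / 4 : ℝ) * τ ^ (-(3 / 4) : ℝ) := by
      calc _ ≤ lossRate d M δ * (2 * d * (2 * (δ ^ (3 / 4 : ℝ) * τ ^ (-(3 / 4) : ℝ)))) := by
            gcongr
            exact h1.trans (by gcongr)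
        _ = 4 * d * heatConst d * M * (δ ^ (-(1 / 2) : ℝ) * δ ^ (3 / 4 : ℝ)) *
            τ ^ (-(3 / 4) : ℝ) := by unfold lossRate; ring
        _ = _ := by rw [e2]
    have h4 := mul_le_mul_of_nonneg_left h2 hM
    unfold consistencyConst
    linarith
  · have e : driftKernel (lossRate d M δ) δ τ c (x - y) -
        lossRate d M δ * heatKernel τ (x - y) + inner ℝ (heatKernelGrad τ (x - y)) c =
        lossRate d M δ * (heatKernel (τ + 2 * δ) (x - y) - heatKernel τ (x - y)) -
          inner ℝ (heatKernelGrad (τ + δ) (x - y) - heatKernelGrad τ (x - y)) c := by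
      rw [driftKernel, inner_sub_left]
      ring
    rw [e, hP]
    refine (abs_sub _ _).trans ?_
    rw [abs_mul, abs_of_nonneg hlam]
    have h1 := abs_real_inner_le_norm
      (heatKernelGrad (τ + δ) (x - y) - heatKernelGrad τ (x - y)) c
    have h2 := mul_le_mul_of_nonneg_left hcM
      (norm_nonneg (heatKernelGrad (τ + δ) (x - y) - heatKernelGrad τ (x - y)))
    dsimp only
    linarith

/-- `w` is bounded by `C` on `(0, T]` and solves there the Duhamel form of the linear equation
`∂ₜw + div (b w) = Δw`, `w(0) = w₀`, with a drift `b` bounded by `M`. -/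
structure IsLinearSolution (M T C : ℝ)
    (b : ℝ → EuclideanSpace ℝ (Fin d) → EuclideanSpace ℝ (Fin d))
    (w₀ : EuclideanSpace ℝ (Fin d) → ℝ) (w : ℝ → EuclideanSpace ℝ (Fin d) → ℝ) : Prop where
  nonneg : 0 ≤ M
  measurable_drift : Measurable (Function.uncurry b)
  norm_drift_le : ∀ s y, ‖b s y‖ ≤ M
  measurable : Measurable (Function.uncurry w)
  bounded : ∀ t ∈ Ioc 0 T, ∀ x, |w t x| ≤ C
  duhamel : ∀ t ∈ Ioc 0 T, ∀ x, w t x = heatFlow w₀ t x +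
    ∫ s in Ioo 0 t, ∫ y, -(inner ℝ (heatKernelGrad (t - s) (x - y)) (b s y) * w s y)

lemma measurable_inner_drift (hb : Measurable (Function.uncurry b)) (t : ℝ) :
    Measurable fun p : EuclideanSpace ℝ (Fin d) × (ℝ × EuclideanSpace ℝ (Fin d)) =>
      (inner ℝ (heatKernelGrad (t - p.2.1) (p.1 - p.2.2)) (b p.2.1 p.2.2) : ℝ) := by
  refine Measurable.inner ?_ (hb.comp measurable_snd)
  exact measurable_heatKernelGrad.comp
    (f := fun p : EuclideanSpace ℝ (Fin d) × (ℝ × EuclideanSpace ℝ (Fin d)) =>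
      (t - p.2.1, p.1 - p.2.2)) (by fun_prop)

lemma measurable_inner_drift_section (hb : Measurable (Function.uncurry b)) (t : ℝ)
    (x : EuclideanSpace ℝ (Fin d)) : Measurable (Function.uncurry fun s y =>
      (inner ℝ (heatKernelGrad (t - s) (x - y)) (b s y) : ℝ)) :=
  (measurable_inner_drift hb t).comp
    (f := fun q : ℝ × EuclideanSpace ℝ (Fin d) => (x, q)) measurable_prodMk_left

variable {T C : ℝ}

lemma IsLinearSolution.abs_inner_le (hw : IsLinearSolution M T C b w₀ w)
    (v : EuclideanSpace ℝ (Fin d)) (s : ℝ) (y : EuclideanSpace ℝ (Fin d)) :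
    |inner ℝ v (b s y)| ≤ M * ‖v‖ := by
  refine (abs_real_inner_le_norm _ _).trans ?_
  rw [mul_comm]
  gcongr
  exact hw.norm_drift_le s y

/-- The weight rate `volterraRate (2 * (M * heatConst d))` lowers the contraction factor of the
drift term to `1/4`; this leaves room to absorb the consistency error into a halving step. -/
lemma setIntegral_contraction_add_consistency_le {κ C' D t : ℝ} (hM : 0 ≤ M) (hκ : 0 ≤ κ)
    (hC' : 0 ≤ C') (hD : 0 ≤ D) (ht : t ∈ Ioc 0 T) :
    IntegrableOn (fun s => M * heatConst d * D *
      ((t - s) ^ (-(1 / 2) : ℝ) * Real.exp (volterraRate (2 * (M * heatConst d)) * s)) +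
        κ * C' * (t - s) ^ (-(3 / 4) : ℝ)) (Ioo 0 t) ∧
    ∫ s in Ioo 0 t, (M * heatConst d * D *
      ((t - s) ^ (-(1 / 2) : ℝ) * Real.exp (volterraRate (2 * (M * heatConst d)) * s)) +
        κ * C' * (t - s) ^ (-(3 / 4) : ℝ)) ≤
      D / 4 * Real.exp (volterraRate (2 * (M * heatConst d)) * t) +
        4 * T ^ (1 / 4 : ℝ) * κ * C' := by
  have hc := heatConst_pos d
  have hm := volterraRate_pos (2 * (M * heatConst d))
  have ia1 := (integrableOn_rpow_mul_exp hm t).const_mul (M * heatConst d * D)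
  have ia2 := (integrableOn_rpow_Ioo (p := -(3 / 4)) (by norm_num) t).const_mul (κ * C')
  refine ⟨ia1.add ia2, ?_⟩
  rw [integral_add ia1 ia2, integral_const_mul, integral_const_mul]
  refine add_le_add ?_ ?_
  · have g1 := mul_le_mul_of_nonneg_left (setIntegral_rpow_mul_exp_le hm t)
      (by positivity : 0 ≤ M * heatConst d * D)
    have g2 := mul_le_mul_of_nonneg_right
      (mul_sqrt_volterraRate_le (A := 2 * (M * heatConst d)) (by positivity))
      (mul_nonneg hD (Real.exp_pos (volterraRate (2 * (M * heatConst d)) * t)).le)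
    linarith
  · rw [setIntegral_rpow_Ioo (by norm_num) ht.1.le]
    have g1 : t ^ (-(3 / 4) + 1 : ℝ) ≤ T ^ (1 / 4 : ℝ) := by
      rw [show (-(3 / 4) + 1 : ℝ) = 1 / 4 by norm_num]
      exact Real.rpow_le_rpow ht.1.le ht.2 (by norm_num)
    calc _ = 4 * t ^ (-(3 / 4) + 1 : ℝ) * κ * C' := by
          norm_num
          ring
      _ ≤ _ := by gcongr

lemma IsLinearSolution.iterated_integrable (hw : IsLinearSolution M T C b w₀ w) {t : ℝ}
    (ht : t ∈ Ioc 0 T) (x : EuclideanSpace ℝ (Fin d)) :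
    (∀ s ∈ Ioo 0 t, Integrable fun y =>
      -(inner ℝ (heatKernelGrad (t - s) (x - y)) (b s y) * w s y)) ∧
    IntegrableOn (fun s => ∫ y, -(inner ℝ (heatKernelGrad (t - s) (x - y)) (b s y) * w s y))
      (Ioo 0 t) := by
  have hm : Measurable (Function.uncurry fun s y =>
      -(inner ℝ (heatKernelGrad (t - s) (x - y)) (b s y) * w s y)) :=
    ((measurable_inner_drift_section hw.measurable_drift t x).mul hw.measurable).neg
  obtain ⟨h1, h2, -⟩ := iterated_integral_bound (μ := volume) (t := t)
    (a := fun s => M * heatConst d * C * (t - s) ^ (-(1 / 2) : ℝ)) hm (fun s hs => by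
    have hC : 0 ≤ C := (abs_nonneg _).trans (hw.bounded t ht x)
    refine ⟨fun y => M * ‖heatKernelGrad (t - s) (x - y)‖ * C,
      ((integrable_heatKernelGrad_sub (sub_pos.2 hs.2) x).norm.const_mul M).mul_const C, ?_,
      fun y => ?_⟩
    · rw [integral_mul_const, integral_const_mul]
      have g1 := integral_norm_heatKernelGrad_comp_sub_le (sub_pos.2 hs.2) x
      have g2 := mul_le_mul_of_nonneg_right (mul_le_mul_of_nonneg_left g1 hw.nonneg) hC
      refine g2.trans (le_of_eq (by ring))
    · rw [abs_neg, abs_mul]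
      exact mul_le_mul (hw.abs_inner_le _ s y) (hw.bounded s ⟨hs.1, hs.2.le.trans ht.2⟩ y)
        (abs_nonneg _) (mul_nonneg hw.nonneg (norm_nonneg _)))
    ((integrableOn_rpow_Ioo (by norm_num) t).const_mul _)
  exact ⟨h1, h2⟩

/-- Halving step in the comparison of a solution `w` with its approximation `W`. -/
lemma IsLinearSolution.approx_sub_le_step (hw : IsLinearSolution M T C b w₀ w)
    (hδ : 0 < δ) (hw₀ : Measurable w₀)
    {G : ℝ} (hG : ∀ x, |w₀ x| ≤ G) (hW : Measurable (Function.uncurry W)) {C' : ℝ}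
    (hWC : ∀ s ∈ Ioc 0 T, ∀ x, |W s x| ≤ C')
    (hWeq : ∀ s > 0, ∀ x, W s x = volterra volume (approxData (lossRate d M δ) w₀)
      (approxKernel (lossRate d M δ) δ b) W s x) {D : ℝ} (hD : 0 ≤ D) {t : ℝ} (ht : t ∈ Ioc 0 T)
    (hDt : ∀ s ∈ Ioo 0 t, ∀ y, |W s y - w s y| ≤
      D * Real.exp (volterraRate (2 * (M * heatConst d)) * s)) (x : EuclideanSpace ℝ (Fin d)) :
    |W t x - w t x| ≤ D / 4 * Real.exp (volterraRate (2 * (M * heatConst d)) * t) +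
      4 * T ^ (1 / 4 : ℝ) * (consistencyConst d M * δ ^ (1 / 4 : ℝ)) * C' := by
  set m := volterraRate (2 * (M * heatConst d)) with hm_def
  have hM := hw.nonneg
  have hc := heatConst_pos d
  have hlam : 0 ≤ lossRate d M δ := by unfold lossRate; positivity
  have hκ := consistencyConst_nonneg (d := d) hM
  have hC' : 0 ≤ C' := (abs_nonneg _).trans (hWC t ht x)
  have hsub : ∀ s ∈ Ioo 0 t, s ∈ Ioc 0 T := fun s hs => ⟨hs.1, hs.2.le.trans ht.2⟩
  set ip : ℝ → EuclideanSpace ℝ (Fin d) → ℝ := fun s y =>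
    inner ℝ (heatKernelGrad (t - s) (x - y)) (b s y) with hip
  set k : ℝ → EuclideanSpace ℝ (Fin d) → ℝ := fun s y =>
    driftKernel (lossRate d M δ) δ (t - s) (b s y) (x - y) -
      lossRate d M δ * heatKernel (t - s) (x - y) with hk
  have hipm : Measurable (Function.uncurry ip) :=
    measurable_inner_drift_section hw.measurable_drift t x
  have hkm : Measurable (Function.uncurry k) := by
    refine Measurable.sub ?_ (Measurable.const_mul ?_ _)
    · exact (measurable_driftKernel _ δ).comp
        (f := fun p : ℝ × EuclideanSpace ℝ (Fin d) => (t - p.1, b p.1 p.2, x - p.2))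
        ((by fun_prop : Measurable fun p : ℝ × EuclideanSpace ℝ (Fin d) => t - p.1).prodMk
          (hw.measurable_drift.prodMk (by fun_prop)))
    · exact measurable_heatKernel.comp
        (f := fun p : ℝ × EuclideanSpace ℝ (Fin d) => (t - p.1, x - p.2)) (by fun_prop)
  -- The difference of the two Duhamel integrands, as a contraction part plus a consistency error.
  set h : ℝ → EuclideanSpace ℝ (Fin d) → ℝ := fun s y =>
    -(ip s y * (W s y - w s y)) + (k s y + ip s y) * W s y with hh
  have hhm : Measurable (Function.uncurry h) :=
    (hipm.mul (hW.sub hw.measurable)).neg.add ((hkm.add hipm).mul hW)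
  obtain ⟨ia, hia⟩ := setIntegral_contraction_add_consistency_le (d := d) hM
    (mul_nonneg hκ (Real.rpow_nonneg hδ.le (1 / 4))) hC' hD ht
  obtain ⟨hh1, hh2, hh3⟩ := iterated_integral_bound (μ := volume) (t := t)
    (a := fun s => M * heatConst d * D * ((t - s) ^ (-(1 / 2) : ℝ) * Real.exp (m * s)) +
      consistencyConst d M * δ ^ (1 / 4 : ℝ) * C' * (t - s) ^ (-(3 / 4) : ℝ)) hhm (fun s hs => by
    obtain ⟨Q, hQi, hQA, hQ⟩ := exists_consistency_bound hδ hM (sub_pos.2 hs.2) x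
    have j1 : Integrable fun y : EuclideanSpace ℝ (Fin d) =>
        M * ‖heatKernelGrad (t - s) (x - y)‖ * (D * Real.exp (m * s)) :=
      ((integrable_heatKernelGrad_sub (sub_pos.2 hs.2) x).norm.const_mul M).mul_const _
    refine ⟨fun y => M * ‖heatKernelGrad (t - s) (x - y)‖ * (D * Real.exp (m * s)) + Q y * C',
      j1.add (hQi.mul_const C'), ?_, fun y => ?_⟩
    · rw [integral_add j1 (hQi.mul_const C'), integral_mul_const, integral_mul_const,
        integral_const_mul]
      have g1 := integral_norm_heatKernelGrad_comp_sub_le (sub_pos.2 hs.2) x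
      have g2 := mul_le_mul_of_nonneg_right (mul_le_mul_of_nonneg_left g1 hM)
        (mul_nonneg hD (Real.exp_pos (m * s)).le)
      have g3 := mul_le_mul_of_nonneg_right hQA hC'
      linarith
    · refine (abs_add_le _ _).trans ?_
      rw [abs_neg, abs_mul, abs_mul]
      refine add_le_add ?_ ?_
      · exact mul_le_mul (hw.abs_inner_le _ s y) (hDt s hs y) (abs_nonneg _) (by positivity)
      · have hq := hQ y (b s y) (hw.norm_drift_le s y)
        exact mul_le_mul hq (hWC s (hsub s hs) y) (abs_nonneg _) ((abs_nonneg _).trans hq))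
    ia
  obtain ⟨hw1, hw2⟩ := hw.iterated_integrable ht x
  have e : W t x - w t x = ∫ s in Ioo 0 t, ∫ y, h s y := by
    rw [approx_duhamel hδ hM hlam hw.measurable_drift hw.norm_drift_le hw₀ hG hW
      (fun s hs => hWC s ⟨hs.1, hs.2.trans ht.2⟩) hWeq ht.1 x, hw.duhamel t ht x,
      add_sub_add_left_eq_sub, sub_eq_iff_eq_add, ← integral_add hh2 hw2]
    refine setIntegral_congr_fun measurableSet_Ioo fun s hs => ?_
    rw [← integral_add (hh1 s hs) (hw1 s hs)]
    refine integral_congr_ae (Eventually.of_forall fun y => ?_)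
    simp only [hh, hk, hip]
    ring
  rw [e]
  exact hh3.trans hia

/-- Once `δ` is small, an approximate solution is close to the solution, uniformly on `(0, T]`. -/
lemma IsLinearSolution.approx_sub_le (hw : IsLinearSolution M T C b w₀ w)
    (hδ : 0 < δ) (hw₀ : Measurable w₀)
    {G : ℝ} (hG : ∀ x, |w₀ x| ≤ G) (hW : Measurable (Function.uncurry W))
    (hWb : ∃ C', ∀ s ∈ Ioc 0 T, ∀ x, |W s x| ≤ C')
    (hWeq : ∀ s > 0, ∀ x, W s x = volterra volume (approxData (lossRate d M δ) w₀)
      (approxKernel (lossRate d M δ) δ b) W s x)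
    {ε : ℝ} (hε : 4 * T ^ (1 / 4 : ℝ) * (consistencyConst d M * δ ^ (1 / 4 : ℝ)) = ε)
    (hε4 : ε * Real.exp (volterraRate (2 * (M * heatConst d)) * T) ≤ 1 / 4)
    {t : ℝ} (ht : t ∈ Ioc 0 T) (x : EuclideanSpace ℝ (Fin d)) :
    |W t x - w t x| ≤
      2 * (ε * C) * Real.exp (volterraRate (2 * (M * heatConst d)) * T) := by
  set m := volterraRate (2 * (M * heatConst d)) with hm_def
  have hm : 0 < m := volterraRate_pos _
  have hT : 0 < T := ht.1.trans_le ht.2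
  have hκ := consistencyConst_nonneg (d := d) hw.nonneg
  have hε0 : 0 ≤ ε := by rw [← hε]; positivity
  have hC : 0 ≤ C := (abs_nonneg _).trans (hw.bounded t ht x)
  obtain ⟨C₀, hC₀⟩ := hWb
  have hC₀0 : 0 ≤ C₀ := (abs_nonneg _).trans (hC₀ t ht x)
  have hexp : ∀ s : ℝ, 0 < s → Real.exp (-(m * s)) ≤ 1 := fun s hs => by
    rw [Real.exp_le_one_iff]
    have := mul_pos hm hs
    linarith
  have key := le_of_halving (ι := Ioc 0 T × EuclideanSpace ℝ (Fin d)) (c := ε * C) (D₀ := C₀ + C)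
    (φ := fun p => |W p.1 p.2 - w p.1 p.2| * Real.exp (-(m * p.1))) (by positivity)
    (by positivity) ?_ ?_ (⟨t, ht⟩, x)
  · have h1 := (le_mul_exp_iff _ _ _).1 key
    refine h1.trans ?_
    have h2 : m * t ≤ m * T := mul_le_mul_of_nonneg_left ht.2 hm.le
    exact mul_le_mul_of_nonneg_left (Real.exp_le_exp.2 h2) (by positivity)
  · rintro ⟨⟨s, hs⟩, y⟩
    have h2 : |W s y - w s y| ≤ C₀ + C := by
      have := abs_sub (W s y) (w s y)
      linarith [hC₀ s hs y, hw.bounded s hs y]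
    calc _ ≤ (C₀ + C) * 1 := mul_le_mul h2 (hexp s hs.1) (Real.exp_pos _).le (by positivity)
      _ = _ := mul_one _
  · rintro D hD hφ ⟨⟨s, hs⟩, y⟩
    have hDs : ∀ r ∈ Ioc 0 T, ∀ z, |W r z - w r z| ≤ D * Real.exp (m * r) := fun r hr z =>
      (le_mul_exp_iff _ _ _).1 (hφ (⟨r, hr⟩, z))
    have hWC : ∀ r ∈ Ioc 0 T, ∀ z, |W r z| ≤ C + D * Real.exp (m * T) := fun r hr z => by
      have h1 := abs_sub_abs_le_abs_sub (W r z) (w r z)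
      have h2 : D * Real.exp (m * r) ≤ D * Real.exp (m * T) :=
        mul_le_mul_of_nonneg_left (Real.exp_le_exp.2 (mul_le_mul_of_nonneg_left hr.2 hm.le)) hD
      linarith [hw.bounded r hr z, hDs r hr z]
    have h := hw.approx_sub_le_step hδ hw₀ hG hW hWC hWeq hD hs
      (fun r hr z => hDs r ⟨hr.1, hr.2.le.trans hs.2⟩ z) y
    rw [hε, ← hm_def] at h
    have h1 := mul_le_mul_of_nonneg_right h (Real.exp_pos (-(m * s))).le
    have h2 : Real.exp (m * s) * Real.exp (-(m * s)) = 1 := by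
      rw [← Real.exp_add]; simp
    have h3 : ε * (C + D * Real.exp (m * T)) * Real.exp (-(m * s)) ≤
        ε * (C + D * Real.exp (m * T)) :=
      mul_le_of_le_one_right (by positivity) (hexp s hs.1)
    have h4 := mul_le_mul_of_nonneg_right hε4 hD
    calc _ ≤ D / 4 * (Real.exp (m * s) * Real.exp (-(m * s))) +
          ε * (C + D * Real.exp (m * T)) * Real.exp (-(m * s)) := by
          refine h1.trans (le_of_eq (by ring))
      _ ≤ D / 2 + ε * C := by rw [h2]; linarith

/-- A solution of the linear equation does not increase its `L¹` norm: it is a uniform limit of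
approximate solutions, which have this property. -/
lemma IsLinearSolution.lintegral_le (hw : IsLinearSolution M T C b w₀ w) (hw₀ : Measurable w₀)
    {G : ℝ} (hG : ∀ x, |w₀ x| ≤ G) {t : ℝ} (ht : t ∈ Ioc 0 T) :
    ∫⁻ x, ‖w t x‖ₑ ≤ ∫⁻ x, ‖w₀ x‖ₑ := by
  set m := volterraRate (2 * (M * heatConst d)) with hm_def
  have hδ : ∀ n : ℕ, (0 : ℝ) < 1 / ((n : ℝ) + 1) := fun n => by positivity
  have hex : ∀ n : ℕ, _ := fun n =>
    exists_approx_solution (lam := lossRate d M (1 / ((n : ℝ) + 1))) (hδ n) hw.nonneg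
      (mul_nonneg (mul_nonneg hw.nonneg (heatConst_pos d).le) (Real.rpow_nonneg (hδ n).le _))
      (by rw [lossRate]) hw.measurable_drift hw.norm_drift_le hw₀ hG
  choose W hWm hWb hWeq hWL using hex
  set ε : ℕ → ℝ := fun n =>
    4 * T ^ (1 / 4 : ℝ) * (consistencyConst d M * (1 / ((n : ℝ) + 1)) ^ (1 / 4 : ℝ)) with hε
  have hεlim : Tendsto ε atTop (𝓝 0) := by
    have h1 := (tendsto_one_div_add_atTop_nhds_zero_nat (𝕜 := ℝ)).rpow_const
      (p := (1 / 4 : ℝ)) (Or.inr (by norm_num))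
    rw [Real.zero_rpow (by norm_num)] at h1
    have h2 := (h1.const_mul (consistencyConst d M)).const_mul (4 * T ^ (1 / 4 : ℝ))
    rwa [mul_zero, mul_zero] at h2
  have hsmall : ∀ᶠ n in atTop, ε n * Real.exp (m * T) ≤ 1 / 4 := by
    have := hεlim.mul_const (Real.exp (m * T))
    rw [zero_mul] at this
    exact this.eventually (eventually_le_nhds (by norm_num))
  have hlim : ∀ x, Tendsto (fun n => W n t x) atTop (𝓝 (w t x)) := by
    intro x
    rw [tendsto_iff_dist_tendsto_zero]
    have hz : Tendsto (fun n => 2 * (ε n * C) * Real.exp (m * T)) atTop (𝓝 0) := by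
      have := ((hεlim.mul_const C).const_mul 2).mul_const (Real.exp (m * T))
      simpa using this
    refine squeeze_zero' (Eventually.of_forall fun _ => dist_nonneg) ?_ hz
    filter_upwards [hsmall] with n hn
    exact hw.approx_sub_le (hδ n) hw₀ hG (hWm n) (hWb n T) (hWeq n) rfl hn ht x
  calc ∫⁻ x, ‖w t x‖ₑ = ∫⁻ x, liminf (fun n => ‖W n t x‖ₑ) atTop :=
        lintegral_congr fun x => ((hlim x).enorm.liminf_eq).symm
    _ ≤ liminf (fun n => ∫⁻ x, ‖W n t x‖ₑ) atTop :=
        lintegral_liminf_le fun n => ((hWm n).comp measurable_prodMk_left).enorm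
    _ ≤ _ := liminf_le_of_le (by isBoundedDefault) fun c hc => by
        obtain ⟨n, hn⟩ := hc.exists
        exact hn.trans (hWL n t)

lemma integral_heatFlow (hw₀ : Integrable w₀) {t : ℝ} (ht : 0 < t) :
    Integrable (heatFlow w₀ t) ∧ ∫ x, heatFlow w₀ t x = ∫ x, w₀ x := by
  have h := integral_integral_conv_mul (integrable_heatKernel ht) hw₀
  have e : heatFlow w₀ t = fun x => ∫ y, heatKernel t (x - y) * w₀ y :=
    funext fun x => heatFlow_of_pos ht x
  rw [e]
  refine ⟨h.1, h.2.trans ?_⟩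
  rw [integral_heatKernel ht, one_mul]

/-- Conservation of mass: the divergence term has integral zero because `∇K^t` has. -/
lemma IsLinearSolution.integral_eq (hw : IsLinearSolution M T C b w₀ w) (hw₀ : Measurable w₀)
    {G : ℝ} (hG : ∀ x, |w₀ x| ≤ G) (hw₀i : Integrable w₀) {t : ℝ} (ht : t ∈ Ioc 0 T) :
    ∫ x, w t x = ∫ x, w₀ x := by
  have hm : Measurable fun p : EuclideanSpace ℝ (Fin d) × (ℝ × EuclideanSpace ℝ (Fin d)) =>
      -(inner ℝ (heatKernelGrad (t - p.2.1) (p.1 - p.2.2)) (b p.2.1 p.2.2) * w p.2.1 p.2.2) :=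
    ((measurable_inner_drift hw.measurable_drift t).mul (hw.measurable.comp measurable_snd)).neg
  set I := ∫⁻ x, ‖w₀ x‖ₑ with hI
  have hIfin : I ≠ ⊤ := hw₀i.2.ne
  have hα : Integrable (fun s => M * (heatConst d * (t - s) ^ (-(1 / 2) : ℝ)))
      (volume.restrict (Ioo 0 t)) :=
    ((integrableOn_rpow_Ioo (by norm_num) t).const_mul _).const_mul _
  have hfin : ∫⁻ x, ∫⁻ s in Ioo 0 t, ∫⁻ y,
      ‖-(inner ℝ (heatKernelGrad (t - s) (x - y)) (b s y) * w s y)‖ₑ ≠ ⊤ := by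
    rw [lintegral_triple_swap (τ := volume.restrict (Ioo 0 t)) hm.enorm]
    refine ne_top_of_le_ne_top (b := (∫⁻ s in Ioo 0 t, ENNReal.ofReal
      (M * (heatConst d * (t - s) ^ (-(1 / 2) : ℝ)))) * I)
      (ENNReal.mul_ne_top hα.lintegral_lt_top.ne hIfin) ?_
    rw [← lintegral_mul_const' _ _ hIfin]
    refine setLIntegral_mono' measurableSet_Ioo fun s hs => ?_
    have hts : 0 < t - s := sub_pos.2 hs.2
    calc _ ≤ ∫⁻ y, ENNReal.ofReal (M * (heatConst d * (t - s) ^ (-(1 / 2) : ℝ))) *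
          ‖w s y‖ₑ := by
          refine lintegral_mono fun y => ?_
          simp only [enorm_neg, enorm_mul]
          rw [lintegral_mul_const' _ _ enorm_ne_top]
          gcongr
          calc _ ≤ ∫⁻ x, ‖M * ‖heatKernelGrad (t - s) (x - y)‖‖ₑ := by
                refine lintegral_mono fun x => ?_
                rw [Real.enorm_eq_ofReal_abs, Real.enorm_eq_ofReal_abs]
                refine ENNReal.ofReal_le_ofReal (le_trans ?_ (le_abs_self _))
                exact hw.abs_inner_le _ s y
            _ = ENNReal.ofReal (∫ x, M * ‖heatKernelGrad (t - s) (x - y)‖) :=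
                lintegral_enorm_of_nonneg
                  (((integrable_heatKernelGrad hts).comp_sub_right y).norm.const_mul M)
                  fun x => mul_nonneg hw.nonneg (norm_nonneg _)
            _ ≤ _ := by
                rw [integral_const_mul,
                  integral_sub_right_eq_self (fun x => ‖heatKernelGrad (t - s) x‖)]
                exact ENNReal.ofReal_le_ofReal
                  (mul_le_mul_of_nonneg_left (integral_norm_heatKernelGrad_le hts) hw.nonneg)
      _ ≤ _ := by
          rw [lintegral_const_mul' _ _ ENNReal.ofReal_ne_top]
          gcongr
          exact hw.lintegral_le hw₀ hG ⟨hs.1, hs.2.le.trans ht.2⟩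
  obtain ⟨hint, hswap⟩ := integral_triple_swap (μ := volume) (ν := volume)
    (τ := volume.restrict (Ioo 0 t)) hm hfin
  obtain ⟨hK, hKeq⟩ := integral_heatFlow hw₀i ht.1
  have hzero : ∫ s in Ioo 0 t, ∫ y, ∫ x,
      -(inner ℝ (heatKernelGrad (t - s) (x - y)) (b s y) * w s y) = 0 := by
    refine setIntegral_eq_zero_of_forall_eq_zero fun s hs => ?_
    have hg := integrable_heatKernelGrad (d := d) (sub_pos.2 hs.2)
    have : ∀ y, ∫ x, -(inner ℝ (heatKernelGrad (t - s) (x - y)) (b s y) * w s y) = 0 := by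
      intro y
      rw [integral_neg, integral_mul_const, integral_sub_right_eq_self
        (fun x => (inner ℝ (heatKernelGrad (t - s) x) (b s y) : ℝ))]
      simp_rw [real_inner_comm (b s y)]
      rw [integral_inner hg, integral_heatKernelGrad]
      simp
    simp [this]
  calc ∫ x, w t x = ∫ x, (heatFlow w₀ t x + ∫ s in Ioo 0 t, ∫ y,
        -(inner ℝ (heatKernelGrad (t - s) (x - y)) (b s y) * w s y)) :=
        integral_congr_ae (Eventually.of_forall fun x => hw.duhamel t ht x)
    _ = ∫ x, w₀ x := by rw [integral_add hK hint, hKeq, hswap, hzero, add_zero]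

end Comparison

/-! ### The difference of two mild solutions -/

section Contraction

variable {d : ℕ} {f : ℝ → EuclideanSpace ℝ (Fin d) → EuclideanSpace ℝ (Fin d)}
  {u₀ v₀ : EuclideanSpace ℝ (Fin d) → ℝ} {u v : ℝ → EuclideanSpace ℝ (Fin d) → ℝ}

lemma duhamelKernel_iterated_integrable
    (hf : Measurable fun p : ℝ × EuclideanSpace ℝ (Fin d) => f p.1 p.2)
    (hu : Measurable (Function.uncurry u)) {t B : ℝ} (hB : ∀ s ∈ Ioo 0 t, ∀ y, ‖f (u s y) y‖ ≤ B)
    (x : EuclideanSpace ℝ (Fin d)) :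
    (∀ s ∈ Ioo 0 t, Integrable fun y => duhamelKernel f t s x y (u s y)) ∧
      IntegrableOn (fun s => ∫ y, duhamelKernel f t s x y (u s y)) (Ioo 0 t) := by
  obtain ⟨h1, h2, -⟩ := iterated_integral_bound (μ := volume) (t := t)
    (a := fun s => heatConst d * B * (t - s) ^ (-(1 / 2) : ℝ))
    (measurable_volterra_section (measurable_duhamelKernel hf) hu t x) (fun s hs => by
      have hB0 : 0 ≤ B := (norm_nonneg _).trans (hB s hs x)
      refine ⟨fun y => ‖heatKernelGrad (t - s) (x - y)‖ * B,
        (integrable_heatKernelGrad_sub (sub_pos.2 hs.2) x).norm.mul_const B, ?_, fun y => ?_⟩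
      · rw [integral_mul_const]
        have := mul_le_mul_of_nonneg_right
          (integral_norm_heatKernelGrad_comp_sub_le (sub_pos.2 hs.2) x) hB0
        linarith
      · rw [duhamelKernel, abs_neg]
        exact (abs_real_inner_le_norm _ _).trans
          (mul_le_mul_of_nonneg_left (hB s hs y) (norm_nonneg _)))
    ((integrableOn_rpow_Ioo (by norm_num) t).const_mul _)
  exact ⟨h1, h2⟩

lemma heatFlow_sub (hu : Measurable u₀) (hv : Measurable v₀) {G : ℝ} (huG : ∀ x, |u₀ x| ≤ G)
    (hvG : ∀ x, |v₀ x| ≤ G) {t : ℝ} (ht : 0 < t) (x : EuclideanSpace ℝ (Fin d)) :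
    heatFlow (fun x => u₀ x - v₀ x) t x = heatFlow u₀ t x - heatFlow v₀ t x := by
  simp_rw [heatFlow_of_pos ht, mul_sub]
  exact integral_sub
    ((integrable_heatKernel_sub ht x).mul_bdd (c := G) hu.aestronglyMeasurable
      (Eventually.of_forall huG))
    ((integrable_heatKernel_sub ht x).mul_bdd (c := G) hv.aestronglyMeasurable
      (Eventually.of_forall hvG))

/-- The drift of the linear equation for the difference of two solutions `u` and `v`: the difference
quotient of the flux between them, on the time interval `(0, T]`. Where `u = v` the inverse makes it
vanish, in agreement with `f u = f v`. -/
noncomputable def differenceDrift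
    (f : ℝ → EuclideanSpace ℝ (Fin d) → EuclideanSpace ℝ (Fin d)) (T : ℝ)
    (u v : ℝ → EuclideanSpace ℝ (Fin d) → ℝ) (s : ℝ) (y : EuclideanSpace ℝ (Fin d)) :
    EuclideanSpace ℝ (Fin d) :=
  (Ioc 0 T).indicator (fun s => (u s y - v s y)⁻¹ • (f (u s y) y - f (v s y) y)) s

lemma measurable_differenceDrift
    (hf : Measurable fun p : ℝ × EuclideanSpace ℝ (Fin d) => f p.1 p.2) (T : ℝ)
    (hu : Measurable (Function.uncurry u)) (hv : Measurable (Function.uncurry v)) :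
    Measurable (Function.uncurry (differenceDrift f T u v)) := by
  have h : ∀ {w : ℝ → EuclideanSpace ℝ (Fin d) → ℝ}, Measurable (Function.uncurry w) →
      Measurable fun p : ℝ × EuclideanSpace ℝ (Fin d) => f (w p.1 p.2) p.2 := fun hw =>
    hf.comp (hw.prodMk measurable_snd)
  have hq : Measurable fun p : ℝ × EuclideanSpace ℝ (Fin d) =>
      (u p.1 p.2 - v p.1 p.2)⁻¹ • (f (u p.1 p.2) p.2 - f (v p.1 p.2) p.2) :=
    (Measurable.inv (hu.sub hv)).smul ((h hu).sub (h hv))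
  exact hq.indicator (s := {p : ℝ × EuclideanSpace ℝ (Fin d) | p.1 ∈ Ioc 0 T})
    (measurable_fst measurableSet_Ioc)

/-- The difference of two mild solutions solves a linear equation with bounded drift. -/
lemma exists_isLinearSolution (hf : IsC2C1Flux f) {T : Fin d → ℝ} (hT : ∀ i, 0 < T i)
    (hper : IsPeriodicFlux T f) (hu₀ : Measurable u₀) (hv₀ : Measurable v₀) {G : ℝ}
    (huG : ∀ x, |u₀ x| ≤ G) (hvG : ∀ x, |v₀ x| ≤ G) (hu : IsMildSolution f u₀ u)
    (hv : IsMildSolution f v₀ v) {t : ℝ} (ht : 0 < t) :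
    ∃ M C b w, IsLinearSolution M t C b (fun x => u₀ x - v₀ x) w ∧
      ∀ x, w t x = u t x - v t x := by
  obtain ⟨u', hu'm, hu'u, hu'⟩ := hu.exists_measurable hf.continuous hu₀
  obtain ⟨v', hv'm, hv'v, hv'⟩ := hv.exists_measurable hf.continuous hv₀
  obtain ⟨C₁, hC₁⟩ := hu.bounded t
  obtain ⟨C₂, hC₂⟩ := hv.bounded t
  set R := max C₁ C₂
  have hu'R : ∀ s ∈ Ioc 0 t, ∀ y, |u' s y| ≤ R := fun s hs y => by
    rw [hu'u s hs.1]
    exact (hC₁ s hs y).trans (le_max_left _ _)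
  have hv'R : ∀ s ∈ Ioc 0 t, ∀ y, |v' s y| ≤ R := fun s hs y => by
    rw [hv'v s hs.1]
    exact (hC₂ s hs y).trans (le_max_right _ _)
  obtain ⟨L, hL⟩ := hf.exists_deriv_bound hT hper R
  obtain ⟨B, hB⟩ := hf.exists_bound hT hper R
  have hlip : ∀ s ∈ Ioc 0 t, ∀ y, ‖f (u' s y) y - f (v' s y) y‖ ≤ |L| * |u' s y - v' s y| :=
    fun s hs y => (hf.lipschitz (convex_Icc _ _) hL (abs_le.1 (hu'R s hs y))
      (abs_le.1 (hv'R s hs y)) y).trans (by gcongr; exact le_abs_self L)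
  refine ⟨|L|, R + R, differenceDrift f t u' v', fun s y => u' s y - v' s y, ?_,
    fun x => by simp only [hu'u t ht, hv'v t ht]⟩
  refine ⟨abs_nonneg _, measurable_differenceDrift hf.continuous.measurable t hu'm hv'm,
    fun s y => ?_, hu'm.sub hv'm, fun s hs y => ?_, fun s hs x => ?_⟩
  · by_cases hs : s ∈ Ioc 0 t
    · rw [differenceDrift, indicator_of_mem hs, norm_smul, norm_inv, Real.norm_eq_abs]
      rcases eq_or_ne |u' s y - v' s y| 0 with h0 | h0
      · rw [h0, inv_zero, zero_mul]
        exact abs_nonneg _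
      · have hpos : 0 < |u' s y - v' s y| := lt_of_le_of_ne (abs_nonneg _) (Ne.symm h0)
        rw [← div_eq_inv_mul, div_le_iff₀ hpos]
        exact hlip s hs y
    · rw [differenceDrift, indicator_of_notMem hs, norm_zero]
      exact abs_nonneg _
  · exact (abs_sub _ _).trans (add_le_add (hu'R s hs y) (hv'R s hs y))
  · have hsub : ∀ r ∈ Ioo 0 s, r ∈ Ioc 0 t := fun r hr => ⟨hr.1, hr.2.le.trans hs.2⟩
    obtain ⟨a1, a2⟩ := duhamelKernel_iterated_integrable (t := s) hf.continuous.measurable hu'm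
      (fun r hr y => hB _ (abs_le.1 (hu'R r (hsub r hr) y)) y) x
    obtain ⟨b1, b2⟩ := duhamelKernel_iterated_integrable (t := s) hf.continuous.measurable hv'm
      (fun r hr y => hB _ (abs_le.1 (hv'R r (hsub r hr) y)) y) x
    rw [hu' s hs.1, hv' s hs.1, volterra, volterra, heatFlow_sub hu₀ hv₀ huG hvG hs.1,
      add_sub_add_comm, ← integral_sub a2 b2]
    congr 1
    refine setIntegral_congr_fun measurableSet_Ioo fun r hr => ?_
    rw [← integral_sub (a1 r hr) (b1 r hr)]
    refine integral_congr_ae (Eventually.of_forall fun y => ?_)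
    have hflux : (u' r y - v' r y) • differenceDrift f t u' v' r y =
        f (u' r y) y - f (v' r y) y := by
      rw [differenceDrift, indicator_of_mem (hsub r hr)]
      rcases eq_or_ne (u' r y - v' r y) 0 with h0 | h0
      · rw [h0, zero_smul, sub_eq_zero.1 h0, sub_self]
      · rw [smul_smul, mul_inv_cancel₀ h0, one_smul]
    simp only [duhamelKernel]
    rw [neg_sub_neg, ← inner_sub_right, ← neg_sub (f (u' r y) y), ← hflux, inner_neg_right,
      inner_smul_right, mul_comm]

/-- `L¹`-contraction and conservation of mass for two mild solutions. -/
theorem IsMildSolution.contraction (hf : IsC2C1Flux f) {T : Fin d → ℝ} (hT : ∀ i, 0 < T i)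
    (hper : IsPeriodicFlux T f) (hu₀ : MemLp u₀ ⊤ volume) (hv₀ : MemLp v₀ ⊤ volume)
    (hu : IsMildSolution f u₀ u) (hv : IsMildSolution f v₀ v)
    (hint : Integrable (fun x => u₀ x - v₀ x) volume) {t : ℝ} (ht : 0 < t) :
    Integrable (fun x => u t x - v t x) volume ∧
      (∫ x, |u t x - v t x|) ≤ ∫ x, |u₀ x - v₀ x| ∧
      (∫ x, (u t x - v t x)) = ∫ x, (u₀ x - v₀ x) := by
  obtain ⟨a, ha, ⟨Ga, hGa⟩, hua⟩ := exists_bounded_version hu₀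
  obtain ⟨c, hc, ⟨Gc, hGc⟩, hvc⟩ := exists_bounded_version hv₀
  obtain ⟨M, C, b, w, hw, hwuv⟩ := exists_isLinearSolution hf hT hper ha hc
    (fun x => (hGa x).trans (le_max_left Ga Gc)) (fun x => (hGc x).trans (le_max_right Ga Gc))
    (hu.congr_ae hua) (hv.congr_ae hvc) ht
  have hae : (fun x => u₀ x - v₀ x) =ᵐ[volume] fun x => a x - c x := hua.sub hvc
  have hi : Integrable (fun x => a x - c x) := hint.congr hae
  have hG : ∀ x, |a x - c x| ≤ Ga + Gc := fun x =>
    (abs_sub _ _).trans (add_le_add (hGa x) (hGc x))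
  have hL := hw.lintegral_le (ha.sub hc) hG ⟨ht, le_rfl⟩
  have hwm : AEStronglyMeasurable (w t) volume :=
    (hw.measurable.comp measurable_prodMk_left).aestronglyMeasurable
  have hwi : Integrable (w t) := ⟨hwm, hL.trans_lt hi.2⟩
  have e : w t = fun x => u t x - v t x := funext hwuv
  have habs : ∫ x, |u₀ x - v₀ x| = ∫ x, ‖a x - c x‖ := integral_congr_ae (hae.fun_comp abs)
  rw [integral_congr_ae hae, habs, ← e]
  refine ⟨hwi, ?_, hw.integral_eq (ha.sub hc) hG hi ⟨ht, le_rfl⟩⟩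
  calc ∫ x, |u t x - v t x| = ∫ x, ‖w t x‖ :=
        integral_congr_ae (Eventually.of_forall fun x => by simp only [hwuv, Real.norm_eq_abs])
    _ = (∫⁻ x, ‖w t x‖ₑ).toReal := integral_norm_eq_lintegral_enorm hwm
    _ ≤ (∫⁻ x, ‖a x - c x‖ₑ).toReal := ENNReal.toReal_mono hi.2.ne hL
    _ = ∫ x, ‖a x - c x‖ := (integral_norm_eq_lintegral_enorm hi.1).symm

end Contraction

/-- Part 1: if `∂_u f` is bounded, `S^t` is defined on all of `L^∞(ℝ^d)`. Part 2: solutions are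
unique, so `S^t u₀` is the value at time `t` of any solution with datum `u₀`. Part 3:
`L¹`-contraction and conservation of mass, wherever `S^t` is defined. -/
theorem mainTheorem4 {d : ℕ}
    (f : ℝ → EuclideanSpace ℝ (Fin d) → EuclideanSpace ℝ (Fin d))
    (hf : IsC2C1Flux f)
    (T : Fin d → ℝ) (hT : ∀ i, 0 < T i) (hper : IsPeriodicFlux T f) :
    ((∃ M : ℝ, ∀ (u : ℝ) (x : EuclideanSpace ℝ (Fin d)), ‖deriv (fun w => f w x) u‖ ≤ M) →
      ∀ u₀ : EuclideanSpace ℝ (Fin d) → ℝ, MemLp u₀ ⊤ volume → ∃ u, IsMildSolution f u₀ u) ∧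
    (∀ u₀ : EuclideanSpace ℝ (Fin d) → ℝ, MemLp u₀ ⊤ volume →
      ∀ u, IsMildSolution f u₀ u → ∀ t : ℝ, 0 < t → nonlinearSemigroup f t u₀ = u t) ∧
    (∀ u₀ v₀ : EuclideanSpace ℝ (Fin d) → ℝ,
      MemLp u₀ ⊤ volume → MemLp v₀ ⊤ volume →
      (∃ u, IsMildSolution f u₀ u) → (∃ v, IsMildSolution f v₀ v) →
      Integrable (fun x => u₀ x - v₀ x) volume →
      ∀ t : ℝ, 0 < t →
        Integrable (fun x => nonlinearSemigroup f t u₀ x - nonlinearSemigroup f t v₀ x) volume ∧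
        (∫ x, |nonlinearSemigroup f t u₀ x - nonlinearSemigroup f t v₀ x|) ≤
          ∫ x, |u₀ x - v₀ x| ∧
        (∫ x, (nonlinearSemigroup f t u₀ x - nonlinearSemigroup f t v₀ x)) =
          ∫ x, (u₀ x - v₀ x)) := by
  refine ⟨fun ⟨M, hM⟩ u₀ hu₀ => exists_isMildSolution hf hT hper hM hu₀,
    fun u₀ hu₀ u hu t ht => nonlinearSemigroup_eq hf hT hper hu₀ hu ht, ?_⟩
  rintro u₀ v₀ hu₀ hv₀ ⟨u, hu⟩ ⟨v, hv⟩ hint t ht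
  rw [nonlinearSemigroup_eq hf hT hper hu₀ hu ht, nonlinearSemigroup_eq hf hT hper hv₀ hv ht]
  exact hu.contraction hf hT hper hu₀ hv₀ hv hint ht
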